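/- Let $(\mathbb X,\mathcal X,\lambda)$ be a $\sigma$-finite measure space and let $\mathbf N$ be the set of all measures on $\mathbb X\times[0,1]$ with values in $\mathbb N_0\cup\{\infty\}$, with the smallest $\sigma$-algebra making all evaluations $\xi\mapsto\xi(A)$, $A$ measurable, measurable. Let $\eta$ be a Poisson random measure on $\mathbb X\times[0,1]$ with intensity $\lambda(dy)\otimes ds$, defined on a probability space $(\Omega,\mathcal F,\mathbb P)$. Assume that $\eta$ is proper: there are random elements $W_1,W_2,\dots$ of $\mathbb X\times[0,1]$ and an $\mathbb N_0\cup\{\infty\}$-valued random variable $\kappa$ with $\eta=\sum_{n=1}^{\kappa}\delta_{W_n}$ almost surely. For a measurable $A\subseteq\mathbb X\times[0,1]$ and a (possibly random) integrand $f$, the integral $\int_A f(y,s)\,\eta(dy,ds)$ denotes the sum $\sum_{n=1}^{\kappa}\mathbf 1_A(W_n)f(W_n)$, and it is well defined if this sum converges absolutely. Let $h:\mathbf N\times\mathbb X\times[0,1]\to\mathbb R$ be measurable with $\mathbb E\int_{\mathbb X}\int_0^1|h(\eta,y,s)|\,ds\,\lambda(dy)<\infty$ and bounded (it suffices that, for some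 constant $C$, almost surely $|h(\eta,y,s)|\le C$ for $\lambda(dy)\otimes ds$-almost every $(y,s)$). No predictability of $h$ is assumed. Let $X_0\in\mathbb R$ and, for $t\in[0,1]$, $$X_t:=X_0+\int_{\mathbb X\times[0,t]}h(\eta-\delta_{(y,s)},y,s)\,\eta(dy,ds)-\int_{\mathbb X}\int_0^t h(\eta,y,s)\,ds\,\lambda(dy).$$ Then the process $(X_t)_{t\in[0,1]}$ is well defined, that is, almost surely both integrals over $\mathbb X\times[0,1]$ converge absolutely, and every $X_t$ is a random variable (up to modification on a null set); and almost surely $t\mapsto X_t$ is càdlàg. Moreover, for every $\phi\in C^1(\mathbb R)$ and every $t\in[0,1]$, almost surely both integrals below converge absolutely and $$\phi(X_t)=\phi(X_0)+\int_{\mathbb X\times[0,t]}\bigl(\phi(X_{s-}+h(\eta-\delta_{(y,s)},y,s))-\phi(X_{s-})\bigr)\,\eta(dy,ds)-\int_{\mathbb X}\int_0^t\phi'(X_s)\,h(\eta,y,s)\,ds\,\lambda(dy).$$ Here $X_{s-}$ is the left limit at $s$, with $X_{0-}$ read as the value of the process at time $0$. -/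

import Mathlib

open MeasureTheory ProbabilityTheory Filter Topology
open scoped ENNReal unitInterval

noncomputable section

/-- The space `𝐍` of all measures on `W` with values in `{0, 1, 2, …} ∪ {∞}`. As a subtype of
`Measure W` it carries the smallest σ-algebra making the evaluations `ξ ↦ ξ A`, for `A` measurable,
measurable. -/
abbrev CountingMeasure (W : Type*) [MeasurableSpace W] : Type _ :=
  {ξ : Measure W // ∀ A, MeasurableSet A → ∃ k : ℕ∞, ξ A = (k : ℝ≥0∞)}

namespace CountingMeasure

variable {W : Type*} [MeasurableSpace W]

theorem sub_dirac_mem (ξ : CountingMeasure W) (w : W) (h : Measure.dirac w ≤ ξ.1) :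
    ∀ A, MeasurableSet A → ∃ k : ℕ∞, (ξ.1 - Measure.dirac w) A = (k : ℝ≥0∞) := by
  intro A hA
  obtain ⟨k, hk⟩ := ξ.2 A hA
  rw [Measure.sub_apply hA h, hk, Measure.dirac_apply' w hA]
  by_cases hw : w ∈ A
  · exact ⟨k - 1, by simp [hw]⟩
  · exact ⟨k, by simp [hw]⟩

open Classical in
/-- The measure `ξ - δ_w`. It is only meaningful when `w` is a point of `ξ`, that is `δ_w ≤ ξ`;
otherwise nothing is removed. -/
def erase (ξ : CountingMeasure W) (w : W) : CountingMeasure W :=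
  if h : Measure.dirac w ≤ ξ.1 then ⟨ξ.1 - Measure.dirac w, sub_dirac_mem ξ w h⟩ else ξ

theorem erase_add_dirac (ξ : CountingMeasure W) (w : W) (h : Measure.dirac w ≤ ξ.1) :
    (ξ.erase w).1 + Measure.dirac w = ξ.1 := by
  rw [erase, dif_pos h]
  exact Measure.sub_add_cancel_of_le h

end CountingMeasure

/-- `η` is a Poisson random measure with intensity `ν` on the probability space `(Ω, P)`. -/
structure IsPoissonMeasure {Ω W : Type*} [MeasurableSpace Ω] [MeasurableSpace W]
    (η : Ω → CountingMeasure W) (ν : Measure W) (P : Measure Ω) : Prop where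
  measurable : Measurable η
  law : ∀ A, MeasurableSet A → ν A ≠ ∞ → ∀ k : ℕ,
    P {ω | (η ω).1 A = (k : ℝ≥0∞)} =
      ENNReal.ofReal (Real.exp (-(ν A).toReal) * (ν A).toReal ^ k / (k.factorial : ℝ))
  law_top : ∀ A, MeasurableSet A → ν A = ∞ → ∀ᵐ ω ∂P, (η ω).1 A = ∞
  indep : ∀ (n : ℕ) (A : Fin n → Set W), (∀ i, MeasurableSet (A i)) →
    Pairwise (fun i j => Disjoint (A i) (A j)) → iIndepFun (fun i ω => (η ω).1 (A i)) P

/-- The random elements `w 0, w 1, …` and the random number `κ` exhibit `η` as a proper point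
process: almost surely, `η` is the sum of the Dirac masses at the points `w n` with `n < κ`. -/
structure IsProperRepresentation {Ω W : Type*} [MeasurableSpace Ω] [MeasurableSpace W]
    (η : Ω → CountingMeasure W) (κ : Ω → ℕ∞) (w : ℕ → Ω → W) (P : Measure Ω) : Prop where
  measurable_count : Measurable κ
  measurable_point : ∀ n, Measurable (w n)
  ae_eq : ∀ᵐ ω ∂P,
    (η ω).1 = Measure.sum (fun n : {n : ℕ // (n : ℕ∞) < κ ω} => Measure.dirac (w n ω))

section PointIntegral

variable {W : Type*}

/-- `f` is (absolutely) integrable over `A` with respect to `∑_{n < κ} δ_{w n}`. -/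
def PointIntegrableOn (κ : ℕ∞) (w : ℕ → W) (A : Set W) (f : W → ℝ) : Prop :=
  Summable (fun n : {n : ℕ // (n : ℕ∞) < κ} => A.indicator f (w n))

/-- The integral of `f` over `A` with respect to `∑_{n < κ} δ_{w n}`. -/
def pointIntegral (κ : ℕ∞) (w : ℕ → W) (A : Set W) (f : W → ℝ) : ℝ :=
  ∑' n : {n : ℕ // (n : ℕ∞) < κ}, A.indicator f (w n)

/-- For measurable integrands, integrability in the sense above is Bochner integrability with
respect to the measure `∑_{n < κ} δ_{w n}`. -/
theorem pointIntegrableOn_iff [MeasurableSpace W] (κ : ℕ∞) (w : ℕ → W) {A : Set W}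
    (hA : MeasurableSet A) {f : W → ℝ} (hf : Measurable f) :
    PointIntegrableOn κ w A f ↔ IntegrableOn f A
      (Measure.sum (fun n : {n : ℕ // (n : ℕ∞) < κ} => Measure.dirac (w n))) := by
  have hm : Measurable (A.indicator f) := hf.indicator hA
  rw [← integrable_indicator_iff hA, PointIntegrableOn, Integrable,
    and_iff_right hm.aestronglyMeasurable, HasFiniteIntegral, lintegral_sum_measure]
  simp only [lintegral_dirac' _ hm.enorm,
    ← summable_norm_iff (f := fun n : {n : ℕ // (n : ℕ∞) < κ} => A.indicator f (w n))]
  constructor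
  · intro h
    have := h.tsum_ofReal_lt_top
    simpa [Real.enorm_eq_ofReal_abs] using this
  · intro h
    have := ENNReal.summable_toReal h.ne
    simpa using this

/-- For measurable integrands, the integral above is the Bochner integral with respect to the
measure `∑_{n < κ} δ_{w n}`. -/
theorem pointIntegral_eq [MeasurableSpace W] (κ : ℕ∞) (w : ℕ → W) {A : Set W}
    (hA : MeasurableSet A) {f : W → ℝ} (hf : Measurable f) (h : PointIntegrableOn κ w A f) :
    pointIntegral κ w A f = ∫ p in A, f p
      ∂(Measure.sum (fun n : {n : ℕ // (n : ℕ∞) < κ} => Measure.dirac (w n))) := by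
  have hm : Measurable (A.indicator f) := hf.indicator hA
  have h2 := (integrable_indicator_iff hA).2 ((pointIntegrableOn_iff κ w hA hf).1 h)
  rw [← integral_indicator hA, pointIntegral, ← (hasSum_integral_measure h2).tsum_eq]
  simp only [integral_dirac' _ _ hm.stronglyMeasurable]

end PointIntegral

/-- The set `𝕏 × [0, t]` in `𝕏 × [0, 1]`. -/
def upTo (X : Type*) (t : I) : Set (X × I) := {p | p.2 ≤ t}

/-- Right-continuity with left limits on `[0, 1]`. -/
def IsCadlag (x : I → ℝ) : Prop :=
  ∀ t : I, ContinuousWithinAt x (Set.Ici t) t ∧ ∃ l : ℝ, Tendsto x (𝓝[<] t) (𝓝 l)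

/-- The path `t ↦ X_t = x₀ + ∫_{𝕏 × [0,t]} h(ξ - δ_{(y,s)}, y, s) ξ(dy, ds)
- ∫_{𝕏 × [0,t]} h(ξ, y, s) lam(dy) ds`, where `ξ = ∑_{n < κ} δ_{w n}`. -/
def itoProcess {X : Type*} [MeasurableSpace X] (lam : Measure X)
    (h : CountingMeasure (X × I) → X × I → ℝ) (x₀ : ℝ)
    (ξ : CountingMeasure (X × I)) (κ : ℕ∞) (w : ℕ → X × I) (t : I) : ℝ :=
  x₀ + pointIntegral κ w (upTo X t) (fun p => h (ξ.erase p) p)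
    - ∫ p in upTo X t, h ξ p ∂(lam.prod volume)

end

/-! The formula is a pathwise identity for functions of bounded variation, which is why
predictability plays no role. Probability enters only to show that almost every path has the right
shape.

By the Mecke equation (`IsPoissonMeasure.lintegral_mecke`), the expected sum of `|h(η - δ_w, w)|`
over the points `w` of `η` equals the expected integral of `|h(η, ·)|`, which is finite. So almost
surely the jumps are absolutely summable and the drift density is integrable: the path is a
constant, plus a pure jump part, minus an absolutely continuous part. Almost surely the jump times
are also positive and pairwise distinct, so each `φ(X_{s-} + h) - φ(X_{s-})` is the true increment
of `φ(X)` at `s`.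

For such a path with finitely many jumps, the chain rule applies between jumps and the increments
telescope (`ito_finite_jumps`). The general case is the limit along finite sets of jumps, by
dominated convergence, since `φ` is Lipschitz on the bounded range of the paths
(`ito_summable_jumps`).

The Mecke equation itself comes from the identity `E[Z F(Z - 1)] = r E[F(Z)]` for a Poisson variable
`Z` of mean `r`. Independence extends it to counts on disjoint sets, splitting into atoms to
arbitrary finite families, and a π-system argument to an identity of measures. -/

/-! ### Chain rule along an absolutely continuous path. -/

theorem AbsolutelyContinuousOnInterval.comp_lipschitzOnWith {f φ : ℝ → ℝ} {K : NNReal} {a b : ℝ}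
    (hf : AbsolutelyContinuousOnInterval f a b)
    (hφ : LipschitzOnWith K φ (f '' Set.uIcc a b)) :
    AbsolutelyContinuousOnInterval (fun x => φ (f x)) a b := by
  rw [absolutelyContinuousOnInterval_iff] at hf ⊢
  intro ε hε
  -- Dividing by `K + 1` rather than `K` covers the case `K = 0`.
  obtain ⟨δ, hδ, H⟩ := hf (ε / (K + 1)) (by positivity)
  refine ⟨δ, hδ, fun E hE hE2 => ?_⟩
  have h1 := H E hE hE2
  calc
    _ ≤ ∑ i ∈ Finset.range E.1, K * dist (f (E.2 i).1) (f (E.2 i).2) := by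
      apply Finset.sum_le_sum
      intro i hi
      exact hφ.dist_le_mul _ ⟨_, (hE.left i hi).left, rfl⟩ _ ⟨_, (hE.left i hi).right, rfl⟩
    _ = K * ∑ i ∈ Finset.range E.1, dist (f (E.2 i).1) (f (E.2 i).2) := by
      rw [Finset.mul_sum]
    _ ≤ K * (ε / (K + 1)) := by gcongr
    _ < (K + 1) * (ε / (K + 1)) := by gcongr; linarith
    _ = ε := by field

/-- The chain rule for the primitive of an integrable function. -/
theorem integral_deriv_comp_primitive {φ g : ℝ → ℝ} (hφ : ContDiff ℝ 1 φ)
    (hg : Integrable g) (c a b : ℝ) :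
    ∫ s in a..b, deriv φ (c + ∫ r in (0 : ℝ)..s, g r) * g s
      = φ (c + ∫ r in (0 : ℝ)..b, g r) - φ (c + ∫ r in (0 : ℝ)..a, g r) := by
  have hi : ∀ u v : ℝ, IntervalIntegrable g volume u v := fun u v => hg.intervalIntegrable
  set G : ℝ → ℝ := fun s => c + ∫ r in (0 : ℝ)..s, g r with hG
  have hG' : G = (fun s => (∫ r in a..s, g r) + (c + ∫ r in (0 : ℝ)..a, g r)) := by
    funext s
    simp only [hG, ← intervalIntegral.integral_add_adjacent_intervals (hi 0 a) (hi a s)]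
    ring
  have hcont : Continuous G := by
    exact continuous_const.add (intervalIntegral.continuous_primitive hi 0)
  have hac : AbsolutelyContinuousOnInterval G a b := by
    have h1 := (hi a b).absolutelyContinuousOnInterval_intervalIntegral (c := a) (by simp)
    have h2 : AbsolutelyContinuousOnInterval (fun _ : ℝ => c + ∫ r in (0 : ℝ)..a, g r) a b :=
      (LipschitzWith.const _).lipschitzOnWith.absolutelyContinuousOnInterval (K := 0)
    rw [hG']
    exact h1.add h2
  have hcomp : IsCompact (G '' Set.uIcc a b) := isCompact_uIcc.image hcont
  -- A `C¹` function is Lipschitz only locally, so a ball containing the compact image of `G` is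
  -- fixed.
  obtain ⟨R, hR⟩ := hcomp.isBounded.subset_closedBall 0
  obtain ⟨K, hK⟩ := hφ.contDiffOn.exists_lipschitzOnWith (s := Metric.closedBall (0 : ℝ) R)
    (by decide) (convex_closedBall _ _) (isCompact_closedBall _ _)
  have hac2 := hac.comp_lipschitzOnWith (hK.mono hR)
  have := hac2.integral_deriv_eq_sub
  rw [← this]
  apply intervalIntegral.integral_congr_ae
  filter_upwards [(hi a b).ae_hasDerivAt_integral] with s hs hsm
  have hs' := hs (Set.uIoc_subset_uIcc hsm) a (by simp)
  have hGs : HasDerivAt G (g s) s := by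
    rw [hG']
    exact hs'.add_const _
  have hd : HasDerivAt φ (deriv φ (G s)) (G s) :=
    ((hφ.differentiable (by simp)) _).hasDerivAt
  exact (hd.comp s hGs).deriv.symm

/-! ### Change of variables for a path with finitely many jumps. -/

section FiniteJumps

variable {J : Type*} (a T : J → ℝ) (x₀ : ℝ) (g : ℝ → ℝ)

theorem abs_path_le {S : Finset J} (hg : Integrable g) (p : J → Prop) [DecidablePred p] (t : ℝ) :
    |x₀ + ∑ j ∈ S, (if p j then a j else 0) + ∫ r in (0 : ℝ)..t, g r|
      ≤ |x₀| + ∑ j ∈ S, |a j| + ∫ r, |g r| := by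
  have h1 : |∑ j ∈ S, (if p j then a j else 0)| ≤ ∑ j ∈ S, |a j| := by
    refine (Finset.abs_sum_le_sum_abs _ _).trans (Finset.sum_le_sum fun j _ => ?_)
    split_ifs <;> simp
  have h2 : |∫ r in (0 : ℝ)..t, g r| ≤ ∫ r, |g r| := by
    have := intervalIntegral.norm_integral_le_integral_norm_uIoc (f := g) (a := 0) (b := t)
      (μ := volume)
    refine this.trans ?_
    exact setIntegral_le_integral hg.norm (ae_of_all _ fun _ => norm_nonneg _)
  calc _ ≤ |x₀| + |∑ j ∈ S, (if p j then a j else 0)| + |∫ r in (0 : ℝ)..t, g r| :=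
        abs_add_three _ _ _
    _ ≤ _ := by gcongr

theorem measurable_finite_path (S : Finset J) (hg : Integrable g) :
    Measurable fun s => x₀ + ∑ j ∈ S, (if T j ≤ s then a j else 0) + ∫ r in (0 : ℝ)..s, g r := by
  have hc : Continuous fun s => ∫ r in (0 : ℝ)..s, g r :=
    intervalIntegral.continuous_primitive (fun u v => hg.intervalIntegrable) 0
  refine (measurable_const.add (Finset.measurable_fun_sum _ fun j _ => ?_)).add hc.measurable
  exact Measurable.ite (measurableSet_Ici (a := T j)) measurable_const measurable_const

theorem integrable_deriv_comp_mul {φ : ℝ → ℝ} (hφ : ContDiff ℝ 1 φ) {α : Type*}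
    [MeasurableSpace α] {μ : Measure α} {Y g : α → ℝ} (hY : AEStronglyMeasurable Y μ) {R : ℝ}
    (hR : ∀ s, |Y s| ≤ R) (hg : Integrable g μ) :
    Integrable (fun s => deriv φ (Y s) * g s) μ := by
  have hd : Continuous (deriv φ) := hφ.continuous_deriv le_rfl
  obtain ⟨L, hL⟩ := (isCompact_closedBall (0 : ℝ) R).exists_bound_of_continuousOn hd.continuousOn
  refine hg.bdd_mul (hd.comp_aestronglyMeasurable hY) (c := L) (ae_of_all _ fun s => hL _ ?_)
  simpa using hR s

/-- Induction on the latest jump. Before `T m` the new jump is invisible and the induction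
hypothesis applies; after `T m` the jump part is constant and the chain rule for the primitive
applies; the increment at `T m` joins the two. Injectivity of `T` makes all other jumps strictly
earlier. -/
theorem ito_finite_jumps {φ : ℝ → ℝ} (hφ : ContDiff ℝ 1 φ) (hg : Integrable g)
    (hinj : Function.Injective T) (hT : ∀ j, 0 < T j) (S : Finset J) : ∀ t : ℝ, 0 ≤ t →
    φ (x₀ + ∑ j ∈ S, (if T j ≤ t then a j else 0) + ∫ r in (0 : ℝ)..t, g r)
      = φ x₀ + ∑ i ∈ S, (if T i ≤ t then
          φ (x₀ + ∑ j ∈ S, (if T j < T i then a j else 0) + (∫ r in (0 : ℝ)..(T i), g r) + a i)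
          - φ (x₀ + ∑ j ∈ S, (if T j < T i then a j else 0) + ∫ r in (0 : ℝ)..(T i), g r) else 0)
        + ∫ s in (0 : ℝ)..t,
          deriv φ (x₀ + ∑ j ∈ S, (if T j ≤ s then a j else 0) + ∫ r in (0 : ℝ)..s, g r) * g s := by
  classical
  induction S using Finset.induction_on_max_value T with
  | empty =>
    intro t ht
    simp [integral_deriv_comp_primitive hφ hg]
  | insert m S hm hmax ih =>
    have hlt : ∀ j ∈ S, T j < T m := fun j hj =>
      lt_of_le_of_ne (hmax j hj) fun e => hm (hinj e ▸ hj)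
    have hint : ∀ (S : Finset J) (u v : ℝ), IntervalIntegrable (fun s => deriv φ
        (x₀ + ∑ j ∈ S, (if T j ≤ s then a j else 0) + ∫ r in (0 : ℝ)..s, g r) * g s)
        volume u v := fun S u v =>
      (integrable_deriv_comp_mul hφ (measurable_finite_path a T x₀ g S hg).aestronglyMeasurable
        (fun s => abs_path_le a x₀ g hg (fun j => T j ≤ s) s) hg).intervalIntegrable
    have hsum : ∀ i ∈ S, ∑ j ∈ insert m S, (if T j < T i then a j else 0)
        = ∑ j ∈ S, (if T j < T i then a j else 0) := fun i hi => by
      rw [Finset.sum_insert hm, if_neg (hlt i hi).le.not_gt, zero_add]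
    have hsumm : ∑ j ∈ insert m S, (if T j < T m then a j else 0) = ∑ j ∈ S, a j := by
      rw [Finset.sum_insert hm, if_neg (lt_irrefl _), zero_add]
      exact Finset.sum_congr rfl fun j hj => if_pos (hlt j hj)
    have hbefore : ∀ s < T m, ∑ j ∈ insert m S, (if T j ≤ s then a j else 0)
        = ∑ j ∈ S, (if T j ≤ s then a j else 0) := fun s hs => by
      rw [Finset.sum_insert hm, if_neg hs.not_ge, zero_add]
    have hafter : ∀ s, T m ≤ s → ∑ j ∈ insert m S, (if T j ≤ s then a j else 0)
        = ∑ j ∈ S, a j + a m := fun s hs => by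
      rw [Finset.sum_insert hm, if_pos hs, add_comm]
      congr 1
      exact Finset.sum_congr rfl fun j hj => if_pos ((hlt j hj).le.trans hs)
    have hafterS : ∀ s, T m ≤ s → ∑ j ∈ S, (if T j ≤ s then a j else 0)
        = ∑ j ∈ S, a j := fun s hs =>
      Finset.sum_congr rfl fun j hj => if_pos ((hlt j hj).le.trans hs)
    intro t ht
    have hjumps : ∑ i ∈ insert m S, (if T i ≤ t then
          φ (x₀ + ∑ j ∈ insert m S, (if T j < T i then a j else 0)
            + (∫ r in (0 : ℝ)..(T i), g r) + a i)
          - φ (x₀ + ∑ j ∈ insert m S, (if T j < T i then a j else 0)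
            + ∫ r in (0 : ℝ)..(T i), g r) else 0)
        = (if T m ≤ t then
          φ (x₀ + ∑ j ∈ S, a j + (∫ r in (0 : ℝ)..(T m), g r) + a m)
          - φ (x₀ + ∑ j ∈ S, a j + ∫ r in (0 : ℝ)..(T m), g r) else 0)
          + ∑ i ∈ S, (if T i ≤ t then
          φ (x₀ + ∑ j ∈ S, (if T j < T i then a j else 0) + (∫ r in (0 : ℝ)..(T i), g r) + a i)
          - φ (x₀ + ∑ j ∈ S, (if T j < T i then a j else 0)
            + ∫ r in (0 : ℝ)..(T i), g r) else 0) := by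
      rw [Finset.sum_insert hm, hsumm]
      congr 1
      exact Finset.sum_congr rfl fun i hi => by rw [hsum i hi]
    rw [hjumps]
    -- Up to `T m` the integrands can differ only at the single point `T m`, a null set.
    have hI : ∀ t, 0 ≤ t → t ≤ T m → ∫ s in (0 : ℝ)..t,
          deriv φ (x₀ + ∑ j ∈ insert m S, (if T j ≤ s then a j else 0)
            + ∫ r in (0 : ℝ)..s, g r) * g s
        = ∫ s in (0 : ℝ)..t,
          deriv φ (x₀ + ∑ j ∈ S, (if T j ≤ s then a j else 0)
            + ∫ r in (0 : ℝ)..s, g r) * g s := fun t ht htm => by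
      apply intervalIntegral.integral_congr_ae
      filter_upwards [Measure.ae_ne volume (T m)] with s hs hsm
      rw [Set.uIoc_of_le ht] at hsm
      simp only [hbefore s (lt_of_le_of_ne (hsm.2.trans htm) hs)]
    rcases lt_or_ge t (T m) with h | h
    · rw [hbefore t h, if_neg h.not_ge, zero_add, hI t ht h.le]
      exact ih t ht
    · rw [hafter t h, if_pos h,
        ← intervalIntegral.integral_add_adjacent_intervals (hint _ 0 (T m)) (hint _ (T m) t),
        hI _ (hT m).le le_rfl]
      have h1 := ih (T m) (hT m).le
      rw [hafterS _ le_rfl] at h1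
      have h2 : ∑ i ∈ S, (if T i ≤ T m then
          φ (x₀ + ∑ j ∈ S, (if T j < T i then a j else 0) + (∫ r in (0 : ℝ)..(T i), g r) + a i)
          - φ (x₀ + ∑ j ∈ S, (if T j < T i then a j else 0)
            + ∫ r in (0 : ℝ)..(T i), g r) else 0)
        = ∑ i ∈ S, (if T i ≤ t then
          φ (x₀ + ∑ j ∈ S, (if T j < T i then a j else 0) + (∫ r in (0 : ℝ)..(T i), g r) + a i)
          - φ (x₀ + ∑ j ∈ S, (if T j < T i then a j else 0)
            + ∫ r in (0 : ℝ)..(T i), g r) else 0) :=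
        Finset.sum_congr rfl fun i hi => by
          rw [if_pos (hlt i hi).le, if_pos ((hlt i hi).le.trans h)]
      rw [h2] at h1
      have h3 : ∫ s in (T m)..t,
          deriv φ (x₀ + ∑ j ∈ insert m S, (if T j ≤ s then a j else 0)
            + ∫ r in (0 : ℝ)..s, g r) * g s
          = φ (x₀ + (∑ j ∈ S, a j + a m) + ∫ r in (0 : ℝ)..t, g r)
            - φ (x₀ + (∑ j ∈ S, a j + a m) + ∫ r in (0 : ℝ)..(T m), g r) := by
        rw [← integral_deriv_comp_primitive hφ hg]
        apply intervalIntegral.integral_congr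
        intro s hs
        rw [Set.uIcc_of_le h] at hs
        simp only [hafter s hs.1]
      rw [h3, show x₀ + ∑ j ∈ S, a j + (∫ r in (0 : ℝ)..(T m), g r) + a m
        = x₀ + (∑ j ∈ S, a j + a m) + ∫ r in (0 : ℝ)..(T m), g r by ring]
      linarith

end FiniteJumps

/-! ### Passage to absolutely summable jumps. -/

section SummableJumps

variable {J : Type*} {a : J → ℝ} (x₀ : ℝ)

theorem summable_ite_of_summable (ha : Summable a) (p : J → Prop) [DecidablePred p] :
    Summable fun j => if p j then a j else 0 :=
  ha.abs.of_norm_bounded fun j => by split_ifs <;> simp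

theorem abs_path_tsum_le (ha : Summable a) {g : ℝ → ℝ} (hg : Integrable g) (p : J → Prop)
    [DecidablePred p] (t : ℝ) :
    |x₀ + ∑' j, (if p j then a j else 0) + ∫ r in (0 : ℝ)..t, g r|
      ≤ |x₀| + ∑' j, |a j| + ∫ r, |g r| := by
  have h : Tendsto (fun S : Finset J =>
      |x₀ + ∑ j ∈ S, (if p j then a j else 0) + ∫ r in (0 : ℝ)..t, g r|) atTop
      (𝓝 |x₀ + ∑' j, (if p j then a j else 0) + ∫ r in (0 : ℝ)..t, g r|) :=
    (((summable_ite_of_summable ha p).hasSum.const_add x₀).add_const _).abs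
  refine le_of_tendsto' h fun S => (abs_path_le a x₀ g hg p t).trans ?_
  gcongr
  exact ha.abs.sum_le_tsum S fun _ _ => abs_nonneg _

theorem measurable_path_tsum [Countable J] (ha : Summable a) (T : J → ℝ) {g : ℝ → ℝ}
    (hg : Integrable g) :
    Measurable fun s => x₀ + ∑' j, (if T j ≤ s then a j else 0) + ∫ r in (0 : ℝ)..s, g r := by
  refine measurable_of_tendsto_metrizable' (atTop : Filter (Finset J))
    (fun S => measurable_finite_path a T x₀ g S hg) (tendsto_pi_nhds.2 fun s => ?_)
  exact ((summable_ite_of_summable ha _).hasSum.const_add x₀).add_const _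

/-- All truncated paths stay in `[-R, R]`. There `φ` is Lipschitz and `φ'` bounded, so the jump
terms are dominated by `K * |a i|` and the drift integrands by `L * |g s|`, uniformly in the
truncation. -/
theorem ito_summable_jumps [Countable J] (ha : Summable a) {T : J → ℝ} {g : ℝ → ℝ} {φ : ℝ → ℝ}
    (hφ : ContDiff ℝ 1 φ) (hg : Integrable g) (hinj : Function.Injective T) (hT : ∀ j, 0 < T j)
    (t : ℝ) (ht : 0 ≤ t) :
    Summable (fun i => if T i ≤ t then
        φ (x₀ + ∑' j, (if T j < T i then a j else 0) + (∫ r in (0 : ℝ)..(T i), g r) + a i)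
        - φ (x₀ + ∑' j, (if T j < T i then a j else 0) + ∫ r in (0 : ℝ)..(T i), g r) else 0) ∧
    φ (x₀ + ∑' j, (if T j ≤ t then a j else 0) + ∫ r in (0 : ℝ)..t, g r)
      = φ x₀ + ∑' i, (if T i ≤ t then
          φ (x₀ + ∑' j, (if T j < T i then a j else 0) + (∫ r in (0 : ℝ)..(T i), g r) + a i)
          - φ (x₀ + ∑' j, (if T j < T i then a j else 0) + ∫ r in (0 : ℝ)..(T i), g r) else 0)
        + ∫ s in (0 : ℝ)..t,
          deriv φ (x₀ + ∑' j, (if T j ≤ s then a j else 0) + ∫ r in (0 : ℝ)..s, g r) * g s := by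
  classical
  set R := |x₀| + ∑' j, |a j| + ∫ r, |g r| with hR
  have haR : ∀ j, |a j| ≤ R := fun j => by
    have h1 := ha.abs.le_tsum j fun _ _ => abs_nonneg _
    have h2 : 0 ≤ ∫ r, |g r| := integral_nonneg fun _ => abs_nonneg _
    have h3 := abs_nonneg x₀
    linarith
  have hSR : ∀ (S : Finset J) (p : J → Prop) [DecidablePred p] (t : ℝ),
      |x₀ + ∑ j ∈ S, (if p j then a j else 0) + ∫ r in (0 : ℝ)..t, g r| ≤ R := fun S p _ t => by
    refine (abs_path_le a x₀ g hg p t).trans ?_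
    rw [hR]
    gcongr
    exact ha.abs.sum_le_tsum S fun _ _ => abs_nonneg _
  have hlim : ∀ (p : J → Prop) [DecidablePred p] (t : ℝ), Tendsto (fun S : Finset J =>
      x₀ + ∑ j ∈ S, (if p j then a j else 0) + ∫ r in (0 : ℝ)..t, g r) atTop
      (𝓝 (x₀ + ∑' j, (if p j then a j else 0) + ∫ r in (0 : ℝ)..t, g r)) := fun p _ t =>
    ((summable_ite_of_summable ha p).hasSum.const_add x₀).add_const _
  -- Radius `2 * R`, because `u + a i` is evaluated with both `|u|` and `|a i|` at most `R`.
  obtain ⟨K, hK⟩ := hφ.contDiffOn.exists_lipschitzOnWith (s := Metric.closedBall (0 : ℝ) (2 * R))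
    (by decide) (convex_closedBall _ _) (isCompact_closedBall _ _)
  have hincr : ∀ u i, |u| ≤ R → |φ (u + a i) - φ u| ≤ K * |a i| := fun u i hu => by
    have h0 : 0 ≤ R := (abs_nonneg _).trans hu
    have := hK.dist_le_mul (u + a i) (by
      rw [mem_closedBall_zero_iff, Real.norm_eq_abs]
      linarith [abs_add_le u (a i), haR i]) u (by
      rw [mem_closedBall_zero_iff, Real.norm_eq_abs]; linarith)
    simpa [Real.dist_eq] using this
  have hφc : Continuous φ := hφ.continuous
  have hdc : Continuous (deriv φ) := hφ.continuous_deriv le_rfl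
  refine ⟨?_, ?_⟩
  · refine (ha.abs.mul_left (K : ℝ)).of_norm_bounded fun i => ?_
    rw [Real.norm_eq_abs]
    split_ifs
    · exact hincr _ i (abs_path_tsum_le x₀ ha hg _ _)
    · simpa using by positivity
  have hfin := fun S : Finset J => ito_finite_jumps a T x₀ g hφ hg hinj hT S t ht
  refine tendsto_nhds_unique ((hφc.tendsto _).comp (hlim (fun j => T j ≤ t) t)) ?_
  refine Tendsto.congr (fun S => (hfin S).symm) ?_
  refine (tendsto_const_nhds.add ?_).add ?_
  -- The truncation `S` appears both as the index range and inside the summands; extending by zero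
  -- to all of `J` makes dominated convergence for series applicable.
  · have hconv : ∀ S : Finset J, ∑ i ∈ S, (if T i ≤ t then
        φ (x₀ + ∑ j ∈ S, (if T j < T i then a j else 0) + (∫ r in (0 : ℝ)..(T i), g r) + a i)
        - φ (x₀ + ∑ j ∈ S, (if T j < T i then a j else 0) + ∫ r in (0 : ℝ)..(T i), g r) else 0)
        = ∑' i, (if i ∈ S then (if T i ≤ t then
        φ (x₀ + ∑ j ∈ S, (if T j < T i then a j else 0) + (∫ r in (0 : ℝ)..(T i), g r) + a i)
        - φ (x₀ + ∑ j ∈ S, (if T j < T i then a j else 0) + ∫ r in (0 : ℝ)..(T i), g r)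
        else 0) else 0) := fun S => by
      rw [tsum_eq_sum (s := S) fun i hi => if_neg hi]
      exact Finset.sum_congr rfl fun i hi => (if_pos hi).symm
    simp only [hconv]
    refine tendsto_tsum_of_dominated_convergence (ha.abs.mul_left (K : ℝ)) (fun i => ?_)
      (Eventually.of_forall fun S i => ?_)
    · by_cases hi : T i ≤ t
      · simp only [if_pos hi]
        refine Tendsto.congr' ((eventually_ge_atTop {i}).mono fun S hS =>
          (if_pos (Finset.singleton_subset_iff.1 hS)).symm) ?_
        have := hlim (fun j => T j < T i) (T i)
        exact ((hφc.tendsto _).comp (this.add_const _)).sub ((hφc.tendsto _).comp this)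
      · simp [if_neg hi]
    · rw [Real.norm_eq_abs]
      have h0 : |(0 : ℝ)| ≤ K * |a i| := by simpa using by positivity
      split_ifs
      · exact hincr _ i (hSR S _ _)
      · exact h0
      · exact h0
  · obtain ⟨L, hL⟩ := (isCompact_closedBall (0 : ℝ) R).exists_bound_of_continuousOn
      hdc.continuousOn
    refine intervalIntegral.tendsto_integral_filter_of_dominated_convergence (fun s => L * |g s|)
      (Eventually.of_forall fun S => ?_) (Eventually.of_forall fun S => ae_of_all _ fun s _ => ?_)
      (hg.abs.const_mul L).intervalIntegrable (ae_of_all _ fun s _ => ?_)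
    · exact (integrable_deriv_comp_mul hφ
        (measurable_finite_path a T x₀ g S hg).aestronglyMeasurable
        (fun s => abs_path_le a x₀ g hg (fun j => T j ≤ s) s) hg).aestronglyMeasurable.restrict
    · rw [norm_mul, Real.norm_eq_abs (g s)]
      gcongr
      exact hL _ (by rw [mem_closedBall_zero_iff]; exact hSR S _ _)
    · exact ((hdc.tendsto _).comp (hlim (fun j => T j ≤ s) s)).mul_const _

end SummableJumps

/-! ### Transfer to paths on `[0, 1]`: càdlàg property, left limits, Itô formula. -/

section UnitInterval

theorem setIntegral_Iic_unitInterval (F : ℝ → ℝ) (t : I) :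
    ∫ s : I in Set.Iic t, F s = ∫ r in (0 : ℝ)..t, F r := by
  have := unitInterval.measurePreserving_coe.setIntegral_preimage_emb
    unitInterval.measurableEmbedding_coe F (Set.Iic (t : ℝ))
  rw [show (Subtype.val ⁻¹' Set.Iic (t : ℝ) : Set I) = Set.Iic t from rfl] at this
  rw [this, Measure.restrict_restrict measurableSet_Iic,
    intervalIntegral.integral_of_le t.2.1, ← integral_Icc_eq_integral_Ioc]
  congr 2
  ext r
  simp only [Set.mem_inter_iff, Set.mem_Iic, Set.mem_Icc]
  exact ⟨fun h => ⟨h.2.1, h.1⟩, fun h => ⟨h.2, h.1, h.2.trans t.2.2⟩⟩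

theorem exists_integrable_extension {g : I → ℝ} (hg : Integrable g) :
    ∃ f : ℝ → ℝ, Integrable f ∧ ∀ s : I, f s = g s := by
  classical
  refine ⟨fun r => if h : r ∈ I then g ⟨r, h⟩ else 0, ?_, fun s => dif_pos s.2⟩
  have h1 : Integrable (fun r => if h : r ∈ I then g ⟨r, h⟩ else 0)
      (volume.restrict (I : Set ℝ)) := by
    rw [← unitInterval.measurePreserving_coe.integrable_comp_emb
      unitInterval.measurableEmbedding_coe]
    exact hg.congr (ae_of_all _ fun s => by simp only [Function.comp_apply, Subtype.coe_prop, dite_true, Subtype.coe_eta])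
  refine (integrableOn_iff_integrable_of_support_subset fun r hr => ?_).1 h1
  by_contra h
  exact hr (dif_neg h)

variable {J : Type*} {a : J → ℝ} {τ : J → I} {x₀ : ℝ} {g : I → ℝ} {x : I → ℝ}

theorem continuous_setIntegral_Iic (hg : Integrable g) :
    Continuous fun t : I => ∫ s in Set.Iic t, g s := by
  obtain ⟨f, hf, hfg⟩ := exists_integrable_extension hg
  simp only [← hfg, setIntegral_Iic_unitInterval]
  exact (intervalIntegral.continuous_primitive (fun _ _ => hf.intervalIntegrable) 0).comp
    continuous_subtype_val

/-- Dominated convergence with bound `|a j|`: as `s` increases to `t`, each condition `τ j ≤ s`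
eventually agrees with `τ j < t`. -/
theorem tendsto_jumpPath_left (ha : Summable a) (hg : Integrable g)
    (hx : ∀ t, x t = x₀ + ∑' j, (if τ j ≤ t then a j else 0) - ∫ s in Set.Iic t, g s) (t : I) :
    Tendsto x (𝓝[<] t)
      (𝓝 (x₀ + ∑' j, (if τ j < t then a j else 0) - ∫ s in Set.Iic t, g s)) := by
  rw [show x = _ from funext hx]
  refine (tendsto_const_nhds.add ?_).sub
    ((continuous_setIntegral_Iic hg).continuousAt.tendsto.mono_left nhdsWithin_le_nhds)
  refine tendsto_tsum_of_dominated_convergence ha.abs (fun j => ?_)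
    (Eventually.of_forall fun s j => by split_ifs <;> simp)
  refine tendsto_const_nhds.congr' ?_
  by_cases h : τ j < t
  · filter_upwards [mem_nhdsWithin_of_mem_nhds (Ioi_mem_nhds h)] with s hs
    rw [if_pos h, if_pos (le_of_lt hs)]
  · filter_upwards [self_mem_nhdsWithin] with s hs
    rw [if_neg h, if_neg fun h' => h (lt_of_le_of_lt h' hs)]

theorem continuousWithinAt_jumpPath_right (ha : Summable a) (hg : Integrable g)
    (hx : ∀ t, x t = x₀ + ∑' j, (if τ j ≤ t then a j else 0) - ∫ s in Set.Iic t, g s) (t : I) :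
    ContinuousWithinAt x (Set.Ici t) t := by
  rw [show x = _ from funext hx]
  refine (tendsto_const_nhds.add ?_).sub
    ((continuous_setIntegral_Iic hg).continuousAt.tendsto.mono_left nhdsWithin_le_nhds)
  refine tendsto_tsum_of_dominated_convergence ha.abs (fun j => ?_)
    (Eventually.of_forall fun s j => by split_ifs <;> simp)
  refine tendsto_const_nhds.congr' ?_
  by_cases h : τ j ≤ t
  · filter_upwards [self_mem_nhdsWithin] with s hs
    rw [if_pos h, if_pos (h.trans hs)]
  · filter_upwards [mem_nhdsWithin_of_mem_nhds (Iio_mem_nhds (not_le.1 h))] with s hs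
    rw [if_neg h, if_neg (not_le.2 hs)]

theorem isCadlag_jumpPath (ha : Summable a) (hg : Integrable g)
    (hx : ∀ t, x t = x₀ + ∑' j, (if τ j ≤ t then a j else 0) - ∫ s in Set.Iic t, g s) :
    IsCadlag x := fun t =>
  ⟨continuousWithinAt_jumpPath_right ha hg hx t, _, tendsto_jumpPath_left ha hg hx t⟩

/-- Positivity of `t` is essential: at `0` the left neighbourhood filter is trivial and
`Function.leftLim` returns `x 0`, which includes any jump at `0`. -/
theorem leftLim_jumpPath (ha : Summable a) (hg : Integrable g)
    (hx : ∀ t, x t = x₀ + ∑' j, (if τ j ≤ t then a j else 0) - ∫ s in Set.Iic t, g s)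
    {t : I} (ht : 0 < t) :
    Function.leftLim x t
      = x₀ + ∑' j, (if τ j < t then a j else 0) - ∫ s in Set.Iic t, g s := by
  have : (𝓝[<] t).NeBot := nhdsLT_neBot_of_exists_lt ⟨0, ht⟩
  exact leftLim_eq_of_tendsto (tendsto_jumpPath_left ha hg hx t)

theorem jumpPath_bounded_measurable [Countable J] (ha : Summable a) (hg : Integrable g)
    (hx : ∀ t, x t = x₀ + ∑' j, (if τ j ≤ t then a j else 0) - ∫ s in Set.Iic t, g s) :
    (∃ R, ∀ t, |x t| ≤ R) ∧ Measurable x := by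
  obtain ⟨f, hf, hfg⟩ := exists_integrable_extension hg
  have hx' : ∀ t : I, x t = x₀ + ∑' j, (if (τ j : ℝ) ≤ t then a j else 0)
      + ∫ r in (0 : ℝ)..t, (-f) r := fun t => by
    rw [hx]
    simp only [← hfg, setIntegral_Iic_unitInterval, Pi.neg_apply, intervalIntegral.integral_neg,
      Subtype.coe_le_coe]
    ring
  refine ⟨⟨|x₀| + ∑' j, |a j| + ∫ r, |(-f) r|, fun t => ?_⟩, ?_⟩
  · rw [hx']
    exact abs_path_tsum_le x₀ ha hf.neg _ _
  · rw [show x = _ from funext hx']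
    exact (measurable_path_tsum x₀ ha (fun j => (τ j : ℝ)) hf.neg).comp measurable_subtype_coe

theorem ito_jumpPath [Countable J] (ha : Summable a) (hg : Integrable g) (hinj : Function.Injective τ)
    (hτ : ∀ j, 0 < τ j)
    (hx : ∀ t, x t = x₀ + ∑' j, (if τ j ≤ t then a j else 0) - ∫ s in Set.Iic t, g s)
    {φ : ℝ → ℝ} (hφ : ContDiff ℝ 1 φ) (t : I) :
    Summable (fun i => if τ i ≤ t then
      φ (Function.leftLim x (τ i) + a i) - φ (Function.leftLim x (τ i)) else 0) ∧
    φ (x t) = φ x₀ + ∑' i, (if τ i ≤ t then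
        φ (Function.leftLim x (τ i) + a i) - φ (Function.leftLim x (τ i)) else 0)
      - ∫ s in Set.Iic t, deriv φ (x s) * g s := by
  have hl := fun i => leftLim_jumpPath ha hg hx (hτ i)
  obtain ⟨f, hf, hfg⟩ := exists_integrable_extension hg
  -- The compensator is subtracted, so the real-line formula is used with drift `-f`.
  have hx' : ∀ t : I, x t = x₀ + ∑' j, (if (τ j : ℝ) ≤ t then a j else 0)
      + ∫ r in (0 : ℝ)..t, (-f) r := fun t => by
    rw [hx]
    simp only [← hfg, setIntegral_Iic_unitInterval, Pi.neg_apply, intervalIntegral.integral_neg,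
      Subtype.coe_le_coe]
    ring
  have hl' : ∀ i, Function.leftLim x (τ i)
      = x₀ + ∑' j, (if (τ j : ℝ) < τ i then a j else 0)
      + ∫ r in (0 : ℝ)..τ i, (-f) r := fun i => by
    rw [hl]
    simp only [← hfg, setIntegral_Iic_unitInterval, Pi.neg_apply, intervalIntegral.integral_neg,
      Subtype.coe_lt_coe]
    ring
  have hint : ∫ s in Set.Iic t, deriv φ (x s) * g s = - ∫ s in (0 : ℝ)..t,
      deriv φ (x₀ + ∑' j, (if (τ j : ℝ) ≤ s then a j else 0) + ∫ r in (0 : ℝ)..s, (-f) r)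
        * (-f) s := by
    rw [← setIntegral_Iic_unitInterval (fun s => deriv φ (x₀ + ∑' j,
      (if (τ j : ℝ) ≤ s then a j else 0) + ∫ r in (0 : ℝ)..s, (-f) r) * (-f) s) t,
      ← integral_neg]
    refine integral_congr_ae (ae_of_all _ fun s => ?_)
    beta_reduce
    rw [← hx' s, Pi.neg_apply, hfg]
    ring
  have := ito_summable_jumps x₀ ha hφ hf.neg (T := fun j => (τ j : ℝ))
    (Subtype.val_injective.comp hinj) (fun j => hτ j) t t.2.1
  rw [hint, hx', sub_neg_eq_add]
  simp only [hl']
  exact this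

end UnitInterval

/-! ### Counting measures given by enumerated points. -/

section PointMeasures

variable {Ω W : Type*} [MeasurableSpace Ω] [MeasurableSpace W]

theorem sum_dirac_apply_eq_encard (s : Set ℕ) (x : ℕ → W) {A : Set W} (hA : MeasurableSet A) :
    Measure.sum (fun n : s => Measure.dirac (x n)) A = ({n ∈ s | x n ∈ A}.encard : ℝ≥0∞) := by
  classical
  rw [Measure.sum_apply _ hA, ← ENNReal.tsum_set_one, tsum_subtype s fun n => Measure.dirac (x n) A,
    tsum_subtype {n ∈ s | x n ∈ A} fun _ => (1 : ℝ≥0∞)]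
  refine tsum_congr fun n => ?_
  by_cases hn : n ∈ s <;> by_cases hx : x n ∈ A <;> simp [Set.indicator, hn, hx, hA]

/-- The counting measure `∑_{n ∈ s} δ_{x n}`. -/
noncomputable def CountingMeasure.ofPoints (s : Set ℕ) (x : ℕ → W) : CountingMeasure W :=
  ⟨Measure.sum (fun n : s => Measure.dirac (x n)), fun _ hA =>
    ⟨_, sum_dirac_apply_eq_encard s x hA⟩⟩

theorem CountingMeasure.ofPoints_apply (s : Set ℕ) (x : ℕ → W) {A : Set W}
    (hA : MeasurableSet A) :
    (CountingMeasure.ofPoints s x).1 A = ({n ∈ s | x n ∈ A}.encard : ℝ≥0∞) :=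
  sum_dirac_apply_eq_encard s x hA

theorem CountingMeasure.ofPoints_apply_eq_tsum (s : Set ℕ) (x : ℕ → W) {A : Set W}
    (hA : MeasurableSet A) :
    (CountingMeasure.ofPoints s x).1 A
      = ∑' n, {n | n ∈ s ∧ x n ∈ A}.indicator (fun _ => (1 : ℝ≥0∞)) n := by
  rw [CountingMeasure.ofPoints_apply s x hA, ← ENNReal.tsum_set_one]
  exact tsum_subtype {n | n ∈ s ∧ x n ∈ A} fun _ => (1 : ℝ≥0∞)

theorem CountingMeasure.ofPoints_apply_diff (s : Set ℕ) (x : ℕ → W) {n : ℕ} (hn : n ∈ s)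
    {A : Set W} (hA : MeasurableSet A) :
    (CountingMeasure.ofPoints s x).1 A
      = (CountingMeasure.ofPoints (s \ {n}) x).1 A + Measure.dirac (x n) A := by
  rw [CountingMeasure.ofPoints_apply _ x hA, CountingMeasure.ofPoints_apply _ x hA,
    Measure.dirac_apply' _ hA]
  by_cases hx : x n ∈ A
  · have : {m ∈ s | x m ∈ A} = insert n {m ∈ s \ {n} | x m ∈ A} := by
      ext m
      by_cases hm : m = n <;> simp [hm, hn, hx]
    rw [this, Set.encard_insert_of_notMem (by simp)]
    simp [hx]
  · have : {m ∈ s | x m ∈ A} = {m ∈ s \ {n} | x m ∈ A} := by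
      ext m
      by_cases hm : m = n <;> simp [hm, hx]
    rw [this]
    simp [hx]

/-- Erasing a point amounts to dropping one index, even if other indices carry the same point: both
sides give the same measure after adding back the finite mass `δ_{x n}`, which cancels. -/
theorem CountingMeasure.erase_ofPoints (s : Set ℕ) (x : ℕ → W) {n : ℕ} (hn : n ∈ s) :
    (CountingMeasure.ofPoints s x).erase (x n) = CountingMeasure.ofPoints (s \ {n}) x := by
  have hle : Measure.dirac (x n) ≤ (CountingMeasure.ofPoints s x).1 :=
    Measure.le_iff.2 fun A hA => by
      rw [CountingMeasure.ofPoints_apply_diff s x hn hA]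
      exact le_add_self
  have h := CountingMeasure.erase_add_dirac _ _ hle
  refine Subtype.ext (Measure.ext fun A hA => ?_)
  have hA' := congrArg (fun m => m A) h
  simp only [Measure.add_apply, CountingMeasure.ofPoints_apply_diff s x hn hA] at hA'
  exact (ENNReal.add_left_inj (measure_ne_top _ _)).1 hA'

theorem CountingMeasure.measurable_apply {A : Set W} (hA : MeasurableSet A) :
    Measurable fun ξ : CountingMeasure W => ξ.1 A :=
  (Measure.measurable_coe hA).comp measurable_subtype_coe

theorem CountingMeasure.measurable_ofPoints {s : Ω → Set ℕ} {x : ℕ → Ω → W}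
    (hs : ∀ n, MeasurableSet {ω | n ∈ s ω}) (hx : ∀ n, Measurable (x n)) :
    Measurable fun ω => CountingMeasure.ofPoints (s ω) (fun n => x n ω) := by
  refine Measurable.subtype_mk (Measure.measurable_of_measurable_coe _ fun A hA => ?_)
  change Measurable fun ω => (CountingMeasure.ofPoints (s ω) fun n => x n ω).1 A
  simp only [CountingMeasure.ofPoints_apply_eq_tsum _ _ hA]
  refine Measurable.tsum fun n => ?_
  exact (measurable_const (a := (1 : ℝ≥0∞))).indicator ((hs n).inter (hx n hA))

end PointMeasures

/-! ### The Mecke identity for Poisson counts. -/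

section PoissonLaw

variable {Ω W : Type*} [MeasurableSpace Ω] [MeasurableSpace W] {P : Measure Ω}
  {η : Ω → CountingMeasure W} {ν : Measure W}

theorem IsPoissonMeasure.measurable_apply (hη : IsPoissonMeasure η ν P) {A : Set W}
    (hA : MeasurableSet A) : Measurable fun ω => (η ω).1 A :=
  (CountingMeasure.measurable_apply hA).comp hη.measurable

theorem tsum_poisson_weights (r : ℝ) (hr : 0 ≤ r) :
    ∑' k : ℕ, ENNReal.ofReal (Real.exp (-r) * r ^ k / (k.factorial : ℝ)) = 1 := by
  have h : HasSum (fun k : ℕ => Real.exp (-r) * r ^ k / (k.factorial : ℝ)) 1 := by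
    have := (NormedSpace.expSeries_div_hasSum_exp (𝔸 := ℝ) r).mul_left (Real.exp (-r))
    rw [← Real.exp_eq_exp_ℝ, ← Real.exp_add, neg_add_cancel, Real.exp_zero] at this
    simpa only [mul_div_assoc] using this
  rw [← ENNReal.ofReal_tsum_of_nonneg (fun k => by positivity) h.summable, h.tsum_eq,
    ENNReal.ofReal_one]

/-- The Poisson weights sum to `1`, so the law of the count has no mass outside `ℕ` and integrals
against it are series. -/
theorem IsPoissonMeasure.lintegral_apply [IsProbabilityMeasure P] (hη : IsPoissonMeasure η ν P)
    {A : Set W} (hA : MeasurableSet A) (hA' : ν A ≠ ∞) (F : ℝ≥0∞ → ℝ≥0∞) :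
    ∫⁻ z, F z ∂(P.map fun ω => (η ω).1 A)
      = ∑' k : ℕ, F k * ENNReal.ofReal
        (Real.exp (-(ν A).toReal) * (ν A).toReal ^ k / (k.factorial : ℝ)) := by
  have hm := hη.measurable_apply hA
  set m := P.map fun ω => (η ω).1 A with hmdef
  have : IsProbabilityMeasure m := Measure.isProbabilityMeasure_map hm.aemeasurable
  have hinj : Function.Injective (Nat.cast : ℕ → ℝ≥0∞) := Nat.cast_injective
  have hk : ∀ k : ℕ, m {(k : ℝ≥0∞)} = ENNReal.ofReal
      (Real.exp (-(ν A).toReal) * (ν A).toReal ^ k / (k.factorial : ℝ)) := fun k => by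
    rw [hmdef, Measure.map_apply hm (measurableSet_singleton _), ← hη.law A hA hA' k]
    rfl
  have hc : (Set.range (Nat.cast : ℕ → ℝ≥0∞)).Countable := Set.countable_range _
  have hC : m (Set.range (Nat.cast : ℕ → ℝ≥0∞)) = 1 := by
    have := lintegral_countable (μ := m) (fun _ => 1) hc
    rw [setLIntegral_one, tsum_range (fun a => 1 * m {a}) hinj] at this
    simp only [this, one_mul, hk]
    exact tsum_poisson_weights _ ENNReal.toReal_nonneg
  have hae : ∀ᵐ z ∂m, z ∈ Set.range (Nat.cast : ℕ → ℝ≥0∞) :=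
    (prob_compl_eq_zero_iff hc.measurableSet).2 hC
  rw [← Measure.restrict_eq_self_of_ae_mem hae, lintegral_countable _ hc,
    tsum_range (fun a => F a * m {a}) hinj]
  exact tsum_congr fun k => by rw [hk]

/-- An index shift: `(k + 1) r^(k+1) / (k+1)! = r · r^k / k!`. The truncated value `0 - 1 = 0` is
harmless because it is multiplied by `z = 0`. -/
theorem IsPoissonMeasure.lintegral_mul_sub_one [IsProbabilityMeasure P]
    (hη : IsPoissonMeasure η ν P) {A : Set W} (hA : MeasurableSet A) (hA' : ν A ≠ ∞)
    (F : ℝ≥0∞ → ℝ≥0∞) :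
    ∫⁻ z, z * F (z - 1) ∂(P.map fun ω => (η ω).1 A)
      = ν A * ∫⁻ z, F z ∂(P.map fun ω => (η ω).1 A) := by
  rw [hη.lintegral_apply hA hA' (fun z => z * F (z - 1)), hη.lintegral_apply hA hA' F,
    tsum_eq_zero_add' ENNReal.summable, ← ENNReal.tsum_mul_left]
  simp only [Nat.cast_zero, zero_mul, zero_add]
  refine tsum_congr fun k => ?_
  have h1 : ((k + 1 : ℕ) : ℝ≥0∞) - 1 = k := by
    push_cast
    exact ENNReal.add_sub_cancel_right ENNReal.one_ne_top
  rw [h1]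
  set r := (ν A).toReal with hr
  have hr0 : 0 ≤ r := ENNReal.toReal_nonneg
  rw [← ENNReal.ofReal_toReal hA', ← hr, mul_right_comm, mul_left_comm _ (F k),
    mul_comm _ (F k), ← ENNReal.ofReal_natCast (k + 1), ← ENNReal.ofReal_mul (by positivity),
    ← ENNReal.ofReal_mul hr0]
  congr 2
  rw [Nat.factorial_succ]
  push_cast
  field_simp
  ring

theorem IsPoissonMeasure.iIndepFun_apply (hη : IsPoissonMeasure η ν P) {ι : Type*} [Fintype ι]
    {D : ι → Set W} (hD : ∀ i, MeasurableSet (D i))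
    (hdisj : Pairwise fun i j => Disjoint (D i) (D j)) :
    iIndepFun (fun i ω => (η ω).1 (D i)) P := by
  let e := Fintype.equivFin ι
  have := hη.indep _ (fun k => D (e.symm k)) (fun k => hD _)
    fun i j hij => hdisj (e.symm.injective.ne hij)
  simpa using this.precomp e.injective

/-- The count of `D j` is independent of the other counts, so by Tonelli the one-variable identity
applies with the other counts frozen. -/
theorem IsPoissonMeasure.lintegral_mul_update [IsProbabilityMeasure P]
    (hη : IsPoissonMeasure η ν P) {ι : Type*} [Fintype ι] [DecidableEq ι] {D : ι → Set W}
    (hD : ∀ i, MeasurableSet (D i)) (hdisj : Pairwise fun i j => Disjoint (D i) (D j)) {j : ι}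
    (hj : ν (D j) ≠ ∞) {F : (ι → ℝ≥0∞) → ℝ≥0∞} (hF : Measurable F) :
    ∫⁻ ω, (η ω).1 (D j) *
        F (Function.update (fun i => (η ω).1 (D i)) j ((η ω).1 (D j) - 1)) ∂P
      = ν (D j) * ∫⁻ ω, F (fun i => (η ω).1 (D i)) ∂P := by
  have hm := fun i => hη.measurable_apply (hD i)
  let T : Finset ι := Finset.univ.erase j
  let combine : ℝ≥0∞ × (T → ℝ≥0∞) → ι → ℝ≥0∞ := fun q i => if h : i ∈ T then q.2 ⟨i, h⟩ else q.1
  have hcomb : Measurable combine := by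
    refine measurable_pi_lambda _ fun i => ?_
    by_cases h : i ∈ T
    · simp only [combine, dif_pos h]
      exact (measurable_pi_apply (⟨i, h⟩ : T)).comp measurable_snd
    · simpa only [combine, dif_neg h] using measurable_fst
  let Z : Ω → ℝ≥0∞ := fun ω => (η ω).1 (D j)
  let Y : Ω → T → ℝ≥0∞ := fun ω i => (η ω).1 (D i)
  have hZ : Measurable Z := hm j
  have hY : Measurable Y := measurable_pi_lambda _ fun i => hm i
  have hind : IndepFun Z Y P := by
    have h := (hη.iIndepFun_apply hD hdisj).indepFun_finset {j} T
      (by simp [T]) (fun i => hm i)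
    exact h.comp (φ := fun v : ({j} : Finset ι) → ℝ≥0∞ => v ⟨j, Finset.mem_singleton_self j⟩)
      (ψ := id) (measurable_pi_apply (⟨j, Finset.mem_singleton_self j⟩ : ({j} : Finset ι)))
      measurable_id
  have hprod := (indepFun_iff_map_prod_eq_prod_map_map hZ.aemeasurable hY.aemeasurable).1 hind
  have hpZ : IsProbabilityMeasure (P.map Z) := Measure.isProbabilityMeasure_map hZ.aemeasurable
  have hpY : IsProbabilityMeasure (P.map Y) := Measure.isProbabilityMeasure_map hY.aemeasurable
  have hc1 : ∀ ω, combine (Z ω, Y ω) = fun i => (η ω).1 (D i) := fun ω => by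
    funext i
    by_cases h : i = j <;> simp [combine, T, Z, Y, h]
  have hc2 : ∀ ω, combine (Z ω - 1, Y ω)
      = Function.update (fun i => (η ω).1 (D i)) j ((η ω).1 (D j) - 1) := fun ω => by
    funext i
    by_cases h : i = j
    · subst h; simp [combine, T, Z]
    · simp [combine, T, Z, Y, h]
  have hFc : Measurable fun q => F (combine q) := hF.comp hcomb
  have hG : Measurable fun q : ℝ≥0∞ × (T → ℝ≥0∞) => q.1 * F (combine (q.1 - 1, q.2)) :=
    measurable_fst.mul (hF.comp (hcomb.comp ((measurable_fst.sub_const 1).prodMk measurable_snd)))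
  calc ∫⁻ ω, (η ω).1 (D j) *
        F (Function.update (fun i => (η ω).1 (D i)) j ((η ω).1 (D j) - 1)) ∂P
      = ∫⁻ q, q.1 * F (combine (q.1 - 1, q.2)) ∂(P.map fun ω => (Z ω, Y ω)) := by
        rw [lintegral_map hG (hZ.prodMk hY)]
        simp only [hc2]
        rfl
    _ = ∫⁻ y, ∫⁻ z, z * F (combine (z - 1, y)) ∂(P.map Z) ∂(P.map Y) := by
        rw [hprod, lintegral_prod_symm _ hG.aemeasurable]
    _ = ∫⁻ y, ν (D j) * ∫⁻ z, F (combine (z, y)) ∂(P.map Z) ∂(P.map Y) := by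
        refine lintegral_congr fun y => ?_
        exact hη.lintegral_mul_sub_one (hD j) hj fun z => F (combine (z, y))
    _ = ν (D j) * ∫⁻ q, F (combine q) ∂((P.map Z).prod (P.map Y)) := by
        rw [lintegral_const_mul' _ _ hj, lintegral_prod_symm _ hFc.aemeasurable]
    _ = _ := by
        rw [← hprod, lintegral_map hFc (hZ.prodMk hY)]
        simp only [hc1]

end PoissonLaw

/-! ### The Mecke equation for a proper Poisson process. -/

section Mecke

variable {Ω W : Type*} [MeasurableSpace Ω] [MeasurableSpace W] {P : Measure Ω}
  {η : Ω → CountingMeasure W} {ν : Measure W} {κ : Ω → ℕ∞} {w : ℕ → Ω → W}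

/-- The points other than the `n`-th one. -/
noncomputable def otherPoints (κ : Ω → ℕ∞) (w : ℕ → Ω → W) (n : ℕ) (ω : Ω) : CountingMeasure W :=
  CountingMeasure.ofPoints ({m : ℕ | (m : ℕ∞) < κ ω} \ {n}) (fun m => w m ω)

theorem IsProperRepresentation.measurableSet_lt (hw : IsProperRepresentation η κ w P) (n : ℕ) :
    MeasurableSet {ω | (n : ℕ∞) < κ ω} :=
  hw.measurable_count (MeasurableSpace.measurableSet_top (s := Set.Ioi (n : ℕ∞)))

theorem IsProperRepresentation.measurable_otherPoints (hw : IsProperRepresentation η κ w P)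
    (n : ℕ) : Measurable (otherPoints κ w n) := by
  refine CountingMeasure.measurable_ofPoints (fun m => ?_) hw.measurable_point
  exact (hw.measurableSet_lt m).inter (MeasurableSet.const (m ∉ ({n} : Set ℕ)))

theorem IsProperRepresentation.ae_eq_ofPoints (hw : IsProperRepresentation η κ w P) :
    ∀ᵐ ω ∂P, η ω = CountingMeasure.ofPoints {m : ℕ | (m : ℕ∞) < κ ω} (fun m => w m ω) :=
  hw.ae_eq.mono fun _ h => Subtype.ext h

/-- `otherPoints` is measurable in `ω`, which is not evident for `erase`; measurability questions
are settled through this almost sure equality. -/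
theorem IsProperRepresentation.ae_erase (hw : IsProperRepresentation η κ w P) :
    ∀ᵐ ω ∂P, ∀ n : ℕ, (n : ℕ∞) < κ ω → (η ω).erase (w n ω) = otherPoints κ w n ω :=
  hw.ae_eq_ofPoints.mono fun ω h n hn => by
    rw [h]
    exact CountingMeasure.erase_ofPoints _ (fun m => w m ω) hn

/-- The reduced Campbell measure of a proper point process. -/
noncomputable def reducedCampbell (κ : Ω → ℕ∞) (w : ℕ → Ω → W) (P : Measure Ω) :
    Measure (CountingMeasure W × W) :=
  Measure.sum fun n : ℕ =>
    (P.restrict {ω | (n : ℕ∞) < κ ω}).map fun ω => (otherPoints κ w n ω, w n ω)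

theorem IsProperRepresentation.lintegral_reducedCampbell (hw : IsProperRepresentation η κ w P)
    {f : CountingMeasure W × W → ℝ≥0∞} (hf : Measurable f) :
    ∫⁻ q, f q ∂(reducedCampbell κ w P)
      = ∫⁻ ω, ∑' n : ℕ, {n : ℕ | (n : ℕ∞) < κ ω}.indicator
        (fun n => f (otherPoints κ w n ω, w n ω)) n ∂P := by
  have hm := fun n => (hw.measurable_otherPoints n).prodMk (hw.measurable_point n)
  rw [reducedCampbell, lintegral_sum_measure, lintegral_tsum fun n => ?_]
  · refine tsum_congr fun n => ?_
    rw [lintegral_map hf (hm n), ← lintegral_indicator (hw.measurableSet_lt n)]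
    rfl
  · exact ((hf.comp (hm n)).indicator (hw.measurableSet_lt n)).aemeasurable

/-- Removing a point of `D j` lowers the count of `D j` by one and, by disjointness, changes no
other count. All points of `D j` thus contribute equally, which produces the factor `(η ω).1 (D j)`
of `lintegral_mul_update`. -/
theorem IsPoissonMeasure.lintegral_reducedCampbell_disjoint [IsProbabilityMeasure P]
    (hη : IsPoissonMeasure η ν P) (hw : IsProperRepresentation η κ w P)
    {ι : Type*} [Fintype ι] {D : ι → Set W}
    (hD : ∀ i, MeasurableSet (D i)) (hdisj : Pairwise fun i j => Disjoint (D i) (D j)) {j : ι}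
    (hj : ν (D j) ≠ ∞) {F : (ι → ℝ≥0∞) → ℝ≥0∞} (hF : Measurable F) :
    ∫⁻ q, (D j).indicator (fun _ => F fun i => q.1.1 (D i)) q.2 ∂(reducedCampbell κ w P)
      = ν (D j) * ∫⁻ ω, F (fun i => (η ω).1 (D i)) ∂P := by
  classical
  have hmeas : Measurable fun q : CountingMeasure W × W =>
      (D j).indicator (fun _ => F fun i => q.1.1 (D i)) q.2 :=
    Measurable.indicator (s := Prod.snd ⁻¹' D j) (f := fun q : CountingMeasure W × W =>
      F fun i => q.1.1 (D i)) (hF.comp (measurable_pi_lambda _ fun i =>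
        (CountingMeasure.measurable_apply (hD i)).comp measurable_fst)) (measurable_snd (hD j))
  rw [hw.lintegral_reducedCampbell hmeas, ← hη.lintegral_mul_update hD hdisj hj hF]
  refine lintegral_congr_ae (hw.ae_eq_ofPoints.mono fun ω h => ?_)
  simp only
  set s := {m : ℕ | (m : ℕ∞) < κ ω} with hs
  set x : ℕ → W := fun m => w m ω
  rw [h, CountingMeasure.ofPoints_apply_eq_tsum s x (hD j), ← ENNReal.tsum_mul_right]
  refine tsum_congr fun n => ?_
  by_cases hn : n ∈ s
  · by_cases hx : x n ∈ D j
    · rw [Set.indicator_of_mem hn, Set.indicator_of_mem hx,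
        Set.indicator_of_mem (show n ∈ {n | n ∈ s ∧ x n ∈ D j} from ⟨hn, hx⟩), one_mul]
      congr 1
      funext i
      rw [← CountingMeasure.ofPoints_apply_eq_tsum s x (hD j)]
      have h1 : ∀ i, (CountingMeasure.ofPoints s x).1 (D i)
        = (otherPoints κ w n ω).1 (D i) + Measure.dirac (x n) (D i) := fun i =>
          CountingMeasure.ofPoints_apply_diff s x hn (hD i)
      by_cases hi : i = j
      · subst hi
        rw [Function.update_self, h1, Measure.dirac_apply_of_mem hx,
          ENNReal.add_sub_cancel_right ENNReal.one_ne_top]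
      · have hxi : x n ∉ D i := fun hxi => Set.disjoint_left.1 (hdisj hi) hxi hx
        rw [Function.update_of_ne hi, h1, Measure.dirac_apply' _ (hD i),
          Set.indicator_of_notMem hxi, add_zero]
    · rw [Set.indicator_of_mem hn, Set.indicator_of_notMem hx,
        Set.indicator_of_notMem (fun h' => hx h'.2), zero_mul]
  · rw [Set.indicator_of_notMem hn, Set.indicator_of_notMem (fun h' => hn h'.1), zero_mul]

/-- The atoms of the field of sets generated by the sets `A i`. -/
def fieldAtom {ι : Type*} (A : ι → Set W) (q : ι → Bool) : Set W := {p | ∀ i, p ∈ A i ↔ q i = true}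

theorem measurableSet_fieldAtom {ι : Type*} [Finite ι] {A : ι → Set W}
    (hA : ∀ i, MeasurableSet (A i)) (q : ι → Bool) : MeasurableSet (fieldAtom A q) := by
  have : fieldAtom A q = ⋂ i, {p | p ∈ A i ↔ q i = true} := by ext; simp [fieldAtom]
  rw [this]
  exact MeasurableSet.iInter fun i => by
    cases q i
    · simpa [Set.compl_def] using (hA i).compl
    · simpa using hA i

omit [MeasurableSpace W] in
theorem pairwise_disjoint_fieldAtom {ι : Type*} (A : ι → Set W) :
    Pairwise fun q r => Disjoint (fieldAtom A q) (fieldAtom A r) := fun _ _ hqr =>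
  Set.disjoint_left.2 fun _ hq hr => hqr <| funext fun i =>
    Bool.eq_iff_iff.2 ((hq i).symm.trans (hr i))

omit [MeasurableSpace W] in
theorem sum_indicator_fieldAtom {ι : Type*} [Fintype ι] [DecidableEq ι] (A : ι → Set W) (i : ι)
    (p : W) (c : ℝ≥0∞) :
    (A i).indicator (fun _ => c) p
      = ∑ q : ι → Bool, if q i then (fieldAtom A q).indicator (fun _ => c) p else 0 := by
  classical
  rw [Finset.sum_eq_single fun k => decide (p ∈ A k)]
  · have : p ∈ fieldAtom A fun k => decide (p ∈ A k) := fun k => by simp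
    by_cases h : p ∈ A i <;> simp [h, this]
  · intro q _ hq
    have : p ∉ fieldAtom A q := fun hp => hq <| funext fun k =>
      Bool.eq_iff_iff.2 (by simpa using (hp k).symm)
    simp [this]
  · simp

theorem measure_eq_sum_fieldAtom {ι : Type*} [Fintype ι] [DecidableEq ι] {A : ι → Set W}
    (hA : ∀ i, MeasurableSet (A i)) (i : ι) (m : Measure W) :
    m (A i) = ∑ q : ι → Bool, if q i then m (fieldAtom A q) else 0 := by
  rw [← lintegral_indicator_one (hA i)]
  simp only [Pi.one_def, sum_indicator_fieldAtom A i _ 1]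
  rw [lintegral_finsetSum]
  · refine Finset.sum_congr rfl fun q _ => ?_
    split_ifs
    · exact lintegral_indicator_one (measurableSet_fieldAtom hA q)
    · simp
  · intro q _
    split_ifs
    · exact measurable_const.indicator (measurableSet_fieldAtom hA q)
    · exact measurable_const

/-- Overlapping sets are cut into disjoint atoms, and every count is a sum of atom counts. Only
atoms inside `A b` need finite intensity, and they inherit it from `A b`. -/
theorem IsPoissonMeasure.lintegral_reducedCampbell_finite [IsProbabilityMeasure P]
    (hη : IsPoissonMeasure η ν P) (hw : IsProperRepresentation η κ w P)
    {ι : Type*} [Fintype ι] {A : ι → Set W} (hA : ∀ i, MeasurableSet (A i)) {b : ι}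
    (hb : ν (A b) ≠ ∞) {F : (ι → ℝ≥0∞) → ℝ≥0∞} (hF : Measurable F) :
    ∫⁻ q, (A b).indicator (fun _ => F fun i => q.1.1 (A i)) q.2 ∂(reducedCampbell κ w P)
      = ν (A b) * ∫⁻ ω, F (fun i => (η ω).1 (A i)) ∂P := by
  classical
  let G : ((ι → Bool) → ℝ≥0∞) → ℝ≥0∞ := fun v => F fun i => ∑ q : ι → Bool, if q i then v q else 0
  have hG : Measurable G := by
    refine hF.comp (measurable_pi_lambda _ fun i => Finset.measurable_fun_sum _ fun q _ => ?_)
    split_ifs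
    · exact measurable_pi_apply q
    · exact measurable_const
  have hFG : ∀ m : Measure W, F (fun i => m (A i)) = G fun q => m (fieldAtom A q) := fun m =>
    congrArg F (funext fun i => measure_eq_sum_fieldAtom hA i m)
  have hD := measurableSet_fieldAtom hA
  simp only [sum_indicator_fieldAtom A b, hFG]
  rw [lintegral_finsetSum, measure_eq_sum_fieldAtom hA b ν, Finset.sum_mul]
  · refine Finset.sum_congr rfl fun q _ => ?_
    split_ifs with hq
    · refine hη.lintegral_reducedCampbell_disjoint hw hD (pairwise_disjoint_fieldAtom A) ?_ hG
      exact measure_ne_top_of_subset (fun p hp => (hp b).2 hq) hb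
    · simp
  · intro q _
    split_ifs
    · exact Measurable.indicator (s := Prod.snd ⁻¹' fieldAtom A q)
        (f := fun q : CountingMeasure W × W => G fun i => q.1.1 (fieldAtom A i))
        (hG.comp (measurable_pi_lambda _ fun i =>
        (CountingMeasure.measurable_apply (hD i)).comp measurable_fst)) (measurable_snd (hD q))
    · exact measurable_const

/-- The values of a counting measure on all measurable sets. -/
def CountingMeasure.evalAll (ξ : CountingMeasure W) : {A : Set W // MeasurableSet A} → ℝ≥0∞ :=
  fun A => ξ.1 A.1

/-- The σ-algebra of the evaluations is the pullback of the product σ-algebra under `evalAll`, so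
preimages of cylinders form a generating π-system. -/
theorem CountingMeasure.generateFrom_cylinders :
    MeasurableSpace.generateFrom
      (Set.preimage CountingMeasure.evalAll ''
        measurableCylinders fun _ : {A : Set W // MeasurableSet A} => ℝ≥0∞)
      = (inferInstance : MeasurableSpace (CountingMeasure W)) := by
  rw [← MeasurableSpace.comap_generateFrom, generateFrom_measurableCylinders]
  change _ = MeasurableSpace.comap Subtype.val (⨆ (s : Set W) (_ : MeasurableSet s),
    MeasurableSpace.comap (fun μ : Measure W => μ s) (borel ℝ≥0∞))
  rw [MeasurableSpace.pi]
  simp only [MeasurableSpace.comap_iSup, MeasurableSpace.comap_comp, iSup_subtype]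
  rfl

theorem generateFrom_measurable_finite (ν : Measure W) [SigmaFinite ν] :
    MeasurableSpace.generateFrom {B : Set W | MeasurableSet B ∧ ν B ≠ ∞}
      = (inferInstance : MeasurableSpace W) := by
  refine le_antisymm (MeasurableSpace.generateFrom_le fun B hB => hB.1) fun B hB => ?_
  have : B = ⋃ n, B ∩ spanningSets ν n := by
    rw [← Set.inter_iUnion, iUnion_spanningSets, Set.inter_univ]
  rw [this]
  refine MeasurableSet.iUnion fun n => MeasurableSpace.measurableSet_generateFrom
    ⟨hB.inter (measurableSet_spanningSets ν n), ?_⟩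
  exact measure_ne_top_of_subset Set.inter_subset_right (measure_spanningSets_lt_top ν n).ne

/-- The Mecke equation, as an identity of measures. -/
theorem IsPoissonMeasure.reducedCampbell_eq_prod [IsProbabilityMeasure P] [SigmaFinite ν]
    (hη : IsPoissonMeasure η ν P) (hw : IsProperRepresentation η κ w P) :
    reducedCampbell κ w P = (P.map η).prod ν := by
  classical
  have hpη : IsProbabilityMeasure (P.map η) :=
    Measure.isProbabilityMeasure_map hη.measurable.aemeasurable
  let h3C : (P.map η).FiniteSpanningSetsIn (Set.preimage CountingMeasure.evalAll ''
        measurableCylinders fun _ : {A : Set W // MeasurableSet A} => ℝ≥0∞) :=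
    { set := fun _ => Set.univ
      set_mem := fun _ => ⟨Set.univ, univ_mem_measurableCylinders _, Set.preimage_univ⟩
      finite := fun _ => measure_lt_top _ _
      spanning := Set.iUnion_const _ }
  let h3D : ν.FiniteSpanningSetsIn {B : Set W | MeasurableSet B ∧ ν B ≠ ∞} :=
    { set := spanningSets ν
      set_mem := fun n => ⟨measurableSet_spanningSets ν n, (measure_spanningSets_lt_top ν n).ne⟩
      finite := measure_spanningSets_lt_top ν
      spanning := iUnion_spanningSets ν }
  refine (Measure.prod_eq_generateFrom CountingMeasure.generateFrom_cylinders
    (generateFrom_measurable_finite ν) ?_ ?_ h3C h3D ?_).symm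
  · rw [show Set.preimage CountingMeasure.evalAll '' measurableCylinders
        (fun _ : {A : Set W // MeasurableSet A} => ℝ≥0∞)
      = {s | ∃ t ∈ measurableCylinders (fun _ : {A : Set W // MeasurableSet A} => ℝ≥0∞),
          CountingMeasure.evalAll ⁻¹' t = s} from rfl]
    exact isPiSystem_measurableCylinders.comap _
  · intro B hB C hC _
    exact ⟨hB.1.inter hC.1, measure_ne_top_of_subset Set.inter_subset_left hB.2⟩
  · rintro _ ⟨t, ht, rfl⟩ B ⟨hB, hB'⟩
    obtain ⟨s, S, hS, rfl⟩ := (mem_measurableCylinders _).1 ht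
    -- The index `none` adds `B` to the sets tested by the cylinder; `F` below ignores that
    -- coordinate.
    let A : Option s → Set W := fun i => i.elim B fun k => k.1.1
    have hA : ∀ i, MeasurableSet (A i) := fun i => by
      cases i with
      | none => exact hB
      | some k => exact k.1.2
    let F : (Option s → ℝ≥0∞) → ℝ≥0∞ := fun v => S.indicator 1 fun k => v (some k)
    have hF : Measurable F := (measurable_one.indicator hS).comp
      (measurable_pi_lambda _ fun k => measurable_pi_apply _)
    have key := hη.lintegral_reducedCampbell_finite hw hA (b := none) hB' hF
    have hcyl : MeasurableSet (CountingMeasure.evalAll ⁻¹' cylinder s S : Set (CountingMeasure W)) :=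
      (measurable_pi_lambda CountingMeasure.evalAll fun A =>
        CountingMeasure.measurable_apply A.2) (hS.cylinder)
    rw [← lintegral_indicator_one (hcyl.prod hB), mul_comm, Measure.map_apply hη.measurable hcyl,
      ← lintegral_indicator_one (hη.measurable hcyl)]
    refine Eq.trans (lintegral_congr fun q => ?_) (key.trans ?_)
    · have h1 : q ∈ (CountingMeasure.evalAll ⁻¹' cylinder s S : Set (CountingMeasure W)) ×ˢ B
          ↔ q.2 ∈ B ∧ (fun k : s => q.1.1 k.1.1) ∈ S := and_comm
      by_cases hq : q.2 ∈ B <;> by_cases hq2 : (fun k : s => q.1.1 k.1.1) ∈ S <;>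
        simp [Set.indicator, h1, A, F, hq, hq2, -Set.mem_prod]
    · rfl

theorem IsPoissonMeasure.lintegral_mecke [IsProbabilityMeasure P] [SigmaFinite ν]
    (hη : IsPoissonMeasure η ν P) (hw : IsProperRepresentation η κ w P)
    {f : CountingMeasure W × W → ℝ≥0∞} (hf : Measurable f) :
    ∫⁻ ω, ∑' n : {n : ℕ // (n : ℕ∞) < κ ω}, f ((η ω).erase (w n ω), w n ω) ∂P
      = ∫⁻ ω, ∫⁻ p, f (η ω, p) ∂ν ∂P := by
  have hpη : IsProbabilityMeasure (P.map η) :=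
    Measure.isProbabilityMeasure_map hη.measurable.aemeasurable
  calc _ = ∫⁻ q, f q ∂(reducedCampbell κ w P) := by
        rw [hw.lintegral_reducedCampbell hf]
        refine lintegral_congr_ae (hw.ae_erase.mono fun ω h => ?_)
        simp only
        rw [← tsum_subtype {n : ℕ | (n : ℕ∞) < κ ω} fun n => f (otherPoints κ w n ω, w n ω)]
        exact tsum_congr fun n => by rw [h n n.2]
    _ = _ := by
        rw [hη.reducedCampbell_eq_prod hw, lintegral_prod _ hf.aemeasurable,
          lintegral_map hf.lintegral_prod_right' hη.measurable]

end Mecke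

/-! ### Jump times are almost surely positive and distinct. -/

section SimpleTimes

variable {Ω : Type*} [MeasurableSpace Ω] {P : Measure Ω} [IsProbabilityMeasure P]

theorem IsPoissonMeasure.measure_two_le {W : Type*} [MeasurableSpace W]
    {η : Ω → CountingMeasure W} {ν : Measure W} (hη : IsPoissonMeasure η ν P) {A : Set W}
    (hA : MeasurableSet A) (hA' : ν A ≠ ∞) : P {ω | 2 ≤ (η ω).1 A} ≤ (ν A) ^ 2 := by
  have hm := hη.measurable_apply hA
  have h0 := hη.law A hA hA' 0
  have h1 := hη.law A hA hA' 1
  set r := (ν A).toReal with hr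
  have hr0 : 0 ≤ r := ENNReal.toReal_nonneg
  have hdisj : Disjoint {ω | (η ω).1 A = ((0 : ℕ) : ℝ≥0∞)} {ω | (η ω).1 A = ((1 : ℕ) : ℝ≥0∞)} :=
    Set.disjoint_left.2 fun ω (ha : _ = _) (hb : _ = _) => by
      rw [ha] at hb
      simp at hb
  have hms : ∀ k : ℕ, MeasurableSet {ω | (η ω).1 A = (k : ℝ≥0∞)} := fun k =>
    hm (measurableSet_singleton _)
  have hsub : {ω | 2 ≤ (η ω).1 A} ⊆
      ({ω | (η ω).1 A = ((0 : ℕ) : ℝ≥0∞)} ∪ {ω | (η ω).1 A = ((1 : ℕ) : ℝ≥0∞)})ᶜ := by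
    intro ω hω h
    change 2 ≤ (η ω).1 A at hω
    rcases h with h | h
    · rw [show (η ω).1 A = _ from h] at hω
      simp at hω
    · rw [show (η ω).1 A = _ from h] at hω
      norm_num at hω
  refine (measure_mono hsub).trans ?_
  rw [prob_compl_eq_one_sub ((hms 0).union (hms 1)), measure_union hdisj (hms 1), h0, h1,
    ← ENNReal.ofReal_add (by positivity) (by positivity), ← ENNReal.ofReal_one,
    ← ENNReal.ofReal_sub _ (by positivity), ← ENNReal.ofReal_toReal hA', ← hr,
    ← ENNReal.ofReal_pow hr0]
  refine ENNReal.ofReal_le_ofReal ?_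
  -- From `e^(-r) ≥ 1 - r` follows `1 - e^(-r) (1 + r) ≤ 1 - (1 - r)(1 + r) = r²`.
  have := Real.add_one_le_exp (-r)
  simp
  nlinarith

theorem volume_floor_fiber_le (K i : ℕ) (hK : 0 < K) :
    volume {s : I | ⌊(K : ℝ) * s⌋₊ = i} ≤ ENNReal.ofReal (1 / K) := by
  have hK' : (0 : ℝ) < K := Nat.cast_pos.2 hK
  have hsub : {s : I | ⌊(K : ℝ) * s⌋₊ = i}
      ⊆ Subtype.val ⁻¹' Set.Ico ((i : ℝ) / K) ((i + 1 : ℝ) / K) := by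
    intro s hs
    have h1 := (Nat.floor_eq_iff (mul_nonneg hK'.le s.2.1)).1 hs
    exact ⟨(div_le_iff₀' hK').2 h1.1, (lt_div_iff₀' hK').2 h1.2⟩
  refine (measure_mono hsub).trans ?_
  rw [unitInterval.measurePreserving_coe.measure_preimage measurableSet_Ico.nullMeasurableSet]
  refine (Measure.restrict_apply_le _ _).trans ?_
  rw [Real.volume_Ico]
  refine ENNReal.ofReal_le_ofReal (le_of_eq ?_)
  field_simp
  ring

variable {X : Type*} [MeasurableSpace X] {lam : Measure X}
  {η : Ω → CountingMeasure (X × I)} {κ : Ω → ℕ∞} {w : ℕ → Ω → X × I}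

/-- Time is cut into cells of length at most `1 / (k + 1)`. A cell holds two points with probability
at most `(M / (k + 1))²`, so the union bound over `k + 2` cells tends to `0`. The extra cell is the
value `k + 1` of the floor, taken at `s = 1`. -/
theorem IsPoissonMeasure.ae_exists_cells_lt_two (hη : IsPoissonMeasure η (lam.prod volume) P)
    {B : Set X} (hB : MeasurableSet B) (hB' : lam B ≠ ∞) :
    ∀ᵐ ω ∂P, ∃ k : ℕ, ∀ i ∈ Finset.range (k + 2),
      ¬ 2 ≤ (η ω).1 (B ×ˢ {s : I | ⌊((k + 1 : ℕ) : ℝ) * s⌋₊ = i}) := by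
  set M := (lam B).toReal with hM
  have hM0 : 0 ≤ M := ENNReal.toReal_nonneg
  have hmeas : ∀ k i : ℕ, MeasurableSet {s : I | ⌊((k + 1 : ℕ) : ℝ) * s⌋₊ = i} := fun k i =>
    (Nat.measurable_floor.comp (measurable_const.mul measurable_subtype_coe))
      (measurableSet_singleton i)
  have hcell : ∀ k i : ℕ, P {ω | 2 ≤ (η ω).1 (B ×ˢ {s : I | ⌊((k + 1 : ℕ) : ℝ) * s⌋₊ = i})}
      ≤ ENNReal.ofReal ((M * (1 / (k + 1 : ℕ))) ^ 2) := fun k i => by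
    have h1 : (lam.prod volume) (B ×ˢ {s : I | ⌊((k + 1 : ℕ) : ℝ) * s⌋₊ = i})
        ≤ ENNReal.ofReal (M * (1 / (k + 1 : ℕ))) := by
      rw [Measure.prod_prod, ENNReal.ofReal_mul hM0, hM, ENNReal.ofReal_toReal hB']
      gcongr
      exact volume_floor_fiber_le (k + 1) i k.succ_pos
    refine (hη.measure_two_le (hB.prod (hmeas k i)) (h1.trans_lt ENNReal.ofReal_lt_top).ne).trans ?_
    rw [ENNReal.ofReal_pow (by positivity)]
    gcongr
  have hbound : ∀ k : ℕ, P {ω | ∀ k : ℕ, ∃ i ∈ Finset.range (k + 2),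
      2 ≤ (η ω).1 (B ×ˢ {s : I | ⌊((k + 1 : ℕ) : ℝ) * s⌋₊ = i})}
      ≤ ENNReal.ofReal (2 * M ^ 2 * (1 / ((k : ℝ) + 1))) := fun k => by
    calc _ ≤ P (⋃ i ∈ Finset.range (k + 2),
          {ω | 2 ≤ (η ω).1 (B ×ˢ {s : I | ⌊((k + 1 : ℕ) : ℝ) * s⌋₊ = i})}) :=
          measure_mono fun ω hω => by simpa using hω k
      _ ≤ ∑ i ∈ Finset.range (k + 2), ENNReal.ofReal ((M * (1 / (k + 1 : ℕ))) ^ 2) :=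
          (measure_biUnion_finset_le _ _).trans (Finset.sum_le_sum fun i _ => hcell k i)
      _ = ENNReal.ofReal ((k + 2 : ℕ) * (M * (1 / (k + 1 : ℕ))) ^ 2) := by
          rw [Finset.sum_const, Finset.card_range, nsmul_eq_mul,
            ENNReal.ofReal_mul (by positivity), ENNReal.ofReal_natCast]
      _ ≤ _ := by
          refine ENNReal.ofReal_le_ofReal ?_
          push_cast
          have hk : (0 : ℝ) ≤ k := Nat.cast_nonneg k
          rw [mul_pow, div_pow, one_pow, show ((k : ℝ) + 2) * (M ^ 2 * (1 / ((k : ℝ) + 1) ^ 2))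
            = M ^ 2 * (1 / ((k : ℝ) + 1)) * (((k : ℝ) + 2) / ((k : ℝ) + 1)) by field_simp]
          have : ((k : ℝ) + 2) / ((k : ℝ) + 1) ≤ 2 := by
            rw [div_le_iff₀ (by positivity)]; linarith
          have h3 : 0 ≤ M ^ 2 * (1 / ((k : ℝ) + 1)) := by positivity
          nlinarith
  have hlim : Tendsto (fun k : ℕ => ENNReal.ofReal (2 * M ^ 2 * (1 / ((k : ℝ) + 1)))) atTop
      (𝓝 0) := by
    have := (tendsto_one_div_add_atTop_nhds_zero_nat (𝕜 := ℝ)).const_mul (2 * M ^ 2)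
    rw [mul_zero] at this
    simpa using ENNReal.tendsto_ofReal this
  have hzero := le_antisymm (ge_of_tendsto' hlim hbound) zero_le
  rw [ae_iff]
  push Not
  exact hzero

theorem IsPoissonMeasure.ae_time_pos (hη : IsPoissonMeasure η (lam.prod volume) P)
    (hw : IsProperRepresentation η κ w P) :
    ∀ᵐ ω ∂P, ∀ n : ℕ, (n : ℕ∞) < κ ω → 0 < (w n ω).2 := by
  have hA : MeasurableSet (Set.univ ×ˢ {0} : Set (X × I)) :=
    MeasurableSet.univ.prod (measurableSet_singleton 0)
  have hA0 : (lam.prod volume) (Set.univ ×ˢ {0} : Set (X × I)) = 0 := by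
    rw [Measure.prod_prod, measure_singleton, mul_zero]
  have h0 := hη.law _ hA (by simp [hA0]) 0
  have h1 : ∀ᵐ ω ∂P, (η ω).1 (Set.univ ×ˢ {0}) = ((0 : ℕ) : ℝ≥0∞) := by
    refine (prob_compl_eq_zero_iff (hη.measurable_apply hA (measurableSet_singleton _))).2 ?_
    rw [hA0] at h0
    refine Eq.trans h0 ?_
    simp
  filter_upwards [h1, hw.ae_eq_ofPoints] with ω hω hη' n hn
  rw [hη', CountingMeasure.ofPoints_apply _ _ hA] at hω
  by_contra hcon
  have hw0 : (w n ω).2 = 0 := le_antisymm (not_lt.1 hcon) (w n ω).2.2.1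
  simp only [Nat.cast_zero, ENat.toENNReal_eq_zero, Set.encard_eq_zero] at hω
  exact Set.eq_empty_iff_forall_notMem.1 hω n ⟨hn, Set.mem_univ _, hw0⟩

/-- Two points with the same time would share a cell in every partition, over any spanning set large
enough to contain both space components. -/
theorem IsPoissonMeasure.ae_time_injective [SigmaFinite lam] (hη : IsPoissonMeasure η (lam.prod volume) P)
    (hw : IsProperRepresentation η κ w P) :
    ∀ᵐ ω ∂P, Function.Injective fun n : {n : ℕ // (n : ℕ∞) < κ ω} => (w n ω).2 := by
  have h1 : ∀ᵐ ω ∂P, ∀ j : ℕ, ∃ k : ℕ, ∀ i ∈ Finset.range (k + 2),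
      ¬ 2 ≤ (η ω).1 (spanningSets lam j ×ˢ {s : I | ⌊((k + 1 : ℕ) : ℝ) * s⌋₊ = i}) :=
    ae_all_iff.2 fun j => hη.ae_exists_cells_lt_two (measurableSet_spanningSets lam j)
      (measure_spanningSets_lt_top lam j).ne
  filter_upwards [h1, hw.ae_eq_ofPoints] with ω hω hη' n m hnm
  by_contra hne
  set j := max (spanningSetsIndex lam (w n ω).1) (spanningSetsIndex lam (w m ω).1)
  obtain ⟨k, hk⟩ := hω j
  have hnj : (w n ω).1 ∈ spanningSets lam j :=
    monotone_spanningSets lam (le_max_left _ _) (mem_spanningSetsIndex lam _)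
  have hmj : (w m ω).1 ∈ spanningSets lam j :=
    monotone_spanningSets lam (le_max_right _ _) (mem_spanningSetsIndex lam _)
  set i := ⌊((k + 1 : ℕ) : ℝ) * ((w n ω).2 : ℝ)⌋₊ with hi
  have hik : i ∈ Finset.range (k + 2) := by
    rw [Finset.mem_range, Nat.lt_succ_iff, hi]
    refine Nat.floor_le_of_le ?_
    exact mul_le_of_le_one_right (by positivity) (w n ω).2.2.2
  refine hk i hik ?_
  have hmeas : MeasurableSet {s : I | ⌊((k + 1 : ℕ) : ℝ) * s⌋₊ = i} :=
    (Nat.measurable_floor.comp (measurable_const.mul measurable_subtype_coe))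
      (measurableSet_singleton i)
  rw [hη', CountingMeasure.ofPoints_apply _ _ ((measurableSet_spanningSets lam j).prod hmeas)]
  have h2 : ({(n : ℕ), (m : ℕ)} : Set ℕ).encard = 2 :=
    Set.encard_pair fun h => hne (Subtype.ext h)
  have hsub : ({(n : ℕ), (m : ℕ)} : Set ℕ) ⊆ {l ∈ {l : ℕ | (l : ℕ∞) < κ ω} |
      w l ω ∈ spanningSets lam j ×ˢ {s : I | ⌊((k + 1 : ℕ) : ℝ) * s⌋₊ = i}} := by
    rintro l (rfl | rfl)
    · exact ⟨n.2, hnj, rfl⟩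
    · refine ⟨m.2, hmj, ?_⟩
      change ⌊_ * (((w m ω).2 : I) : ℝ)⌋₊ = i
      rw [hi, show (w n ω).2 = (w m ω).2 from hnm]
  have h3 := Set.encard_le_encard hsub
  rw [h2] at h3
  exact_mod_cast ENat.toENNReal_le.2 h3

end SimpleTimes

/-! ### Sums over the points: measurability and absolute convergence. -/

section PointSums

variable {Ω W : Type*} [MeasurableSpace Ω] [MeasurableSpace W] {P : Measure Ω}
  {η : Ω → CountingMeasure W} {ν : Measure W} {κ : Ω → ℕ∞} {w : ℕ → Ω → W}

/-- Measurability of series is taken as the hypothesis `hsum`, so that one statement serves both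
`ℝ≥0∞`-valued and real-valued sums. -/
theorem IsProperRepresentation.aemeasurable_tsum_erase {E : Type*} [AddCommMonoid E]
    [TopologicalSpace E] [MeasurableSpace E] (hw : IsProperRepresentation η κ w P)
    (hsum : ∀ u : ℕ → Ω → E, (∀ n, Measurable (u n)) → Measurable fun ω => ∑' n, u n ω)
    {f : CountingMeasure W × W → E} (hf : Measurable f) :
    AEMeasurable (fun ω => ∑' n : {n : ℕ // (n : ℕ∞) < κ ω}, f ((η ω).erase (w n ω), w n ω)) P := by
  refine ⟨fun ω => ∑' n : ℕ, {ω | (n : ℕ∞) < κ ω}.indicator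
    (fun ω => f (otherPoints κ w n ω, w n ω)) ω, hsum _ fun n => ?_, ?_⟩
  · exact (hf.comp ((hw.measurable_otherPoints n).prodMk (hw.measurable_point n))).indicator
      (hw.measurableSet_lt n)
  · refine hw.ae_erase.mono fun ω h => ?_
    refine Eq.trans (tsum_congr fun n : {n : ℕ // (n : ℕ∞) < κ ω} => by rw [h n n.2])
      (tsum_subtype {n : ℕ | (n : ℕ∞) < κ ω} fun n => f (otherPoints κ w n ω, w n ω))

theorem IsPoissonMeasure.ae_summable_erase [IsProbabilityMeasure P] [SigmaFinite ν]
    (hη : IsPoissonMeasure η ν P) (hw : IsProperRepresentation η κ w P)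
    {h : CountingMeasure W → W → ℝ} (h_meas : Measurable (Function.uncurry h))
    (h_int : ∫⁻ ω, ∫⁻ p, ‖h (η ω) p‖ₑ ∂ν ∂P < ∞) :
    ∀ᵐ ω ∂P, Summable fun n : {n : ℕ // (n : ℕ∞) < κ ω} => h ((η ω).erase (w n ω)) (w n ω) := by
  have hf : Measurable fun q : CountingMeasure W × W => ‖Function.uncurry h q‖ₑ := h_meas.enorm
  have hlt := ae_lt_top' (hw.aemeasurable_tsum_erase (fun u hu => Measurable.tsum hu) hf)
    (by rw [hη.lintegral_mecke hw hf]; exact h_int.ne)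
  filter_upwards [hlt] with ω hω
  have := ENNReal.summable_toReal hω.ne
  rw [← summable_norm_iff]
  simpa using this

end PointSums

/-! ### Assembly of the pathwise formula and the almost sure properties. -/

theorem upTo_eq_prod (X : Type*) (t : I) : upTo X t = Set.univ ×ˢ Set.Iic t := by
  ext p; simp [upTo]

theorem measurableSet_upTo (X : Type*) [MeasurableSpace X] (t : I) :
    MeasurableSet (upTo X t) := by
  rw [upTo_eq_prod]; exact MeasurableSet.univ.prod measurableSet_Iic

theorem setIntegral_upTo {X : Type*} [MeasurableSpace X] {lam : Measure X} [SigmaFinite lam]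
    {F : X × I → ℝ} (hF : Integrable F (lam.prod volume)) (t : I) :
    ∫ p in upTo X t, F p ∂(lam.prod volume) = ∫ s in Set.Iic t, ∫ y, F (y, s) ∂lam := by
  have h := hF.restrict (s := upTo X t)
  rw [upTo_eq_prod, ← Measure.prod_restrict, Measure.restrict_univ] at h ⊢
  exact integral_prod_symm F h

theorem mainTheorem11 {Ω X : Type*} [MeasurableSpace Ω] [MeasurableSpace X]
    (P : Measure Ω) [IsProbabilityMeasure P] (lam : Measure X) [SigmaFinite lam]
    (η : Ω → CountingMeasure (X × I)) (hη : IsPoissonMeasure η (lam.prod volume) P)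
    (κ : Ω → ℕ∞) (w : ℕ → Ω → X × I) (hw : IsProperRepresentation η κ w P)
    (h : CountingMeasure (X × I) → X × I → ℝ)
    (h_meas : Measurable (Function.uncurry h))
    (h_int : ∫⁻ ω, ∫⁻ p, ‖h (η ω) p‖ₑ ∂(lam.prod volume) ∂P < ∞)
    (h_bdd : ∃ C : ℝ, ∀ᵐ ω ∂P, ∀ᵐ p ∂(lam.prod volume), |h (η ω) p| ≤ C)
    (x₀ : ℝ) (Xp : Ω → I → ℝ)
    (hXp : ∀ ω t, Xp ω t = itoProcess lam h x₀ (η ω) (κ ω) (fun n => w n ω) t) :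
    -- the process is well defined: both integrals converge absolutely, almost surely,
    -- and each `X_t` is a random variable
    (∀ᵐ ω ∂P,
      PointIntegrableOn (κ ω) (fun n => w n ω) Set.univ (fun p => h ((η ω).erase p) p) ∧
      Integrable (h (η ω)) (lam.prod volume)) ∧
    (∀ t, AEMeasurable (fun ω => Xp ω t) P) ∧
    -- it is almost surely càdlàg
    (∀ᵐ ω ∂P, IsCadlag (Xp ω)) ∧
    -- the Itô formula, with all its terms well defined
    (∀ φ : ℝ → ℝ, ContDiff ℝ 1 φ → ∀ t : I, ∀ᵐ ω ∂P,
      PointIntegrableOn (κ ω) (fun n => w n ω) (upTo X t)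
        (fun p => φ (Function.leftLim (Xp ω) p.2 + h ((η ω).erase p) p)
          - φ (Function.leftLim (Xp ω) p.2)) ∧
      IntegrableOn (fun p : X × I => deriv φ (Xp ω p.2) * h (η ω) p) (upTo X t)
        (lam.prod volume) ∧
      φ (Xp ω t) = φ x₀
        + pointIntegral (κ ω) (fun n => w n ω) (upTo X t)
            (fun p => φ (Function.leftLim (Xp ω) p.2 + h ((η ω).erase p) p)
              - φ (Function.leftLim (Xp ω) p.2))
        - ∫ p in upTo X t, deriv φ (Xp ω p.2) * h (η ω) p ∂(lam.prod volume)) := by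
  have hsum := hη.ae_summable_erase hw h_meas h_int
  have hmη : ∀ ω, Measurable (h (η ω)) := fun ω => h_meas.comp measurable_prodMk_left
  have hcomp : Measurable fun q : Ω × (X × I) => h (η q.1) q.2 :=
    h_meas.comp ((hη.measurable.comp measurable_fst).prodMk measurable_snd)
  have hint : ∀ᵐ ω ∂P, Integrable (h (η ω)) (lam.prod volume) := by
    have := ae_lt_top' (Measurable.lintegral_prod_right' (ν := lam.prod volume)
      hcomp.enorm).aemeasurable h_int.ne
    exact this.mono fun ω hω => ⟨(hmη ω).aestronglyMeasurable, hω⟩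
  have hg : ∀ᵐ ω ∂P, Integrable fun s : I => ∫ y, h (η ω) (y, s) ∂lam :=
    hint.mono fun ω hω => hω.integral_prod_right
  have hind : ∀ (ω : Ω) (t : I) (f : X × I → ℝ) (n : {n : ℕ // (n : ℕ∞) < κ ω}),
      (upTo X t).indicator f (w n ω) = if (w n ω).2 ≤ t then f (w n ω) else 0 := fun ω t f n => by
    by_cases hn : (w n ω).2 ≤ t <;> simp [upTo, hn]
  -- Integrating out the space variable by Fubini brings almost every path into the deterministic
  -- form, with jump `h ((η ω).erase (w n ω)) (w n ω)` at time `(w n ω).2`.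
  have hpath : ∀ᵐ ω ∂P, ∀ t, Xp ω t = x₀ + ∑' n : {n : ℕ // (n : ℕ∞) < κ ω},
      (if (w n ω).2 ≤ t then h ((η ω).erase (w n ω)) (w n ω) else 0)
      - ∫ s in Set.Iic t, ∫ y, h (η ω) (y, s) ∂lam := hint.mono fun ω hω t => by
    rw [hXp, itoProcess, setIntegral_upTo hω, pointIntegral]
    simp only [hind]
  refine ⟨?_, fun t => ?_, ?_, fun φ hφ t => ?_⟩
  · filter_upwards [hsum, hint] with ω h1 h2
    refine ⟨?_, h2⟩
    simpa only [PointIntegrableOn, Set.indicator_univ] using h1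
  · simp only [hXp, itoProcess]
    refine (AEMeasurable.add aemeasurable_const ?_).sub ?_
    · have hf : Measurable fun q : CountingMeasure (X × I) × (X × I) =>
          (Prod.snd ⁻¹' upTo X t).indicator (Function.uncurry h) q :=
        h_meas.indicator (measurable_snd (measurableSet_upTo X t))
      exact hw.aemeasurable_tsum_erase (fun u hu => Measurable.tsum hu) hf
    · exact (hcomp.stronglyMeasurable.integral_prod_right'
        (ν := (lam.prod volume).restrict (upTo X t))).measurable.aemeasurable
  · filter_upwards [hsum, hg, hpath] with ω h1 h2 h3
    exact isCadlag_jumpPath h1 h2 h3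
  · filter_upwards [hsum, hint, hg, hpath, hη.ae_time_pos hw, hη.ae_time_injective hw]
      with ω h1 hi h2 h3 hpos hinj
    obtain ⟨hs, hito⟩ := ito_jumpPath h1 h2 hinj (fun n => hpos n n.2) h3 hφ t
    obtain ⟨⟨R, hR⟩, hXm⟩ := jumpPath_bounded_measurable h1 h2 h3
    have hF : Integrable (fun p : X × I => deriv φ (Xp ω p.2) * h (η ω) p) (lam.prod volume) :=
      integrable_deriv_comp_mul hφ (Y := fun p : X × I => Xp ω p.2)
        (hXm.comp measurable_snd).aestronglyMeasurable (fun p => hR p.2) hi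
    refine ⟨?_, hF.integrableOn, ?_⟩
    · simpa only [PointIntegrableOn, hind] using hs
    · rw [setIntegral_upTo hF]
      simp only [pointIntegral, hind, integral_const_mul]
      exact hito
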